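/- Let $n \ge 1$, let $V \in L^\infty(\mathbb{R}^n)$ be real-valued with $V(x) \to 0$ as $|x| \to \infty$ (that is, for every $\varepsilon > 0$ there is $R$ with $|V(x)| \le \varepsilon$ for almost every $|x| \ge R$), and let $H_0 = \Delta^2$ and $H = \Delta^2 + V$ be the self-adjoint operators in $L^2(\mathbb{R}^n)$ with domain $H^4(\mathbb{R}^n)$. Let $P_{ac}(H)$ be the orthogonal projection of $L^2$ onto the absolutely continuous spectral subspace of $H$, and let $H^2 = H^2(\mathbb{R}^n)$ carry the norm $\|u\|_{H^2} = \|(1-\Delta)u\|_{L^2}$. Then the following hold, for each choice of the sign $\pm$ separately. 1. If the wave operator $$W_\pm = \operatorname*{s-lim}_{t \to \pm\infty} e^{itH}e^{-itH_0}$$ exists on $L^2$, then it exists on $H^2$: for every $t \in \mathbb{R}$ the operator $e^{itH}e^{-itH_0}$ restricts to a bounded operator on $H^2$, and these restrictions converge strongly on $H^2$, in the norm of $H^2$, to a bounded operator on $H^2$ as $t \to \pm\infty$. 2. If the inverse wave operator $$\Omega_\pm = \operatorname*{s-lim}_{t \to \pm\infty} e^{itH_0}e^{-itH}P_{ac}(H)$$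 exists on $L^2$, then it exists on $H^2$, in the same sense. -/

import Mathlib

open MeasureTheory Filter Topology TemperedDistribution
open scoped ENNReal SchwartzMap Laplacian

noncomputable section

/-! ### Unitary groups, absolutely continuous subspaces and strong limits -/

section Abstract

variable {E : Type*} [NormedAddCommGroup E] [InnerProductSpace ℂ E] [CompleteSpace E]

/-- `U` is the one-parameter group `t ↦ e^{itA}`: a strongly continuous one-parameter group of
unitary operators on `E` whose infinitesimal generator (with its full domain) is `iA`. -/
structure IsUnitaryGroup (A : E →ₗ.[ℂ] E) (U : ℝ → E →L[ℂ] E) : Prop where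
  map_zero : U 0 = 1
  map_add : ∀ s t, U (s + t) = U s ∘L U t
  mem_unitary : ∀ t, U t ∈ unitary (E →L[ℂ] E)
  continuous : ∀ u, Continuous fun t => U t u
  mem_graph_iff : ∀ u v, (u, v) ∈ A.graph ↔ HasDerivAt (fun t => U t u) (Complex.I • v) 0

open Classical in
/-- The unitary group `t ↦ e^{itA}` of a self-adjoint operator `A`. By Stone's theorem it exists
(and is unique, see `IsUnitaryGroup.unique`) if `A` is self-adjoint; for an operator that
generates no unitary group the value is irrelevant. -/
def unitaryGroup (A : E →ₗ.[ℂ] E) : ℝ → E →L[ℂ] E :=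
  if h : ∃ U, IsUnitaryGroup A U then h.choose else 1

theorem IsUnitaryGroup.hasDerivAt {A : E →ₗ.[ℂ] E} {U : ℝ → E →L[ℂ] E}
    (hU : IsUnitaryGroup A U) {u v : E} (h : (u, v) ∈ A.graph) (t : ℝ) :
    HasDerivAt (fun s => U s u) (Complex.I • U t v) t := by
  have h0 := (hU.mem_graph_iff u v).1 h
  have h1 : HasDerivAt (fun s => U (s - t) u) (Complex.I • v) t := by
    have h0' : HasDerivAt (fun s => U s u) (Complex.I • v) (t - t) := by simpa using h0
    simpa using h0'.comp_sub_const t t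
  have h2 := ((U t).restrictScalars ℝ).hasFDerivAt.comp_hasDerivAt t h1
  have e : (((U t).restrictScalars ℝ) ∘ fun s => U (s - t) u) = fun s => U s u := by
    funext s
    have := hU.map_add t (s - t)
    simp only [add_sub_cancel] at this
    simp [this]
  rw [e] at h2
  simpa using h2

/-- A densely defined operator has at most one unitary group. -/
theorem IsUnitaryGroup.unique {A : E →ₗ.[ℂ] E} (hA : Dense (A.domain : Set E))
    {U U' : ℝ → E →L[ℂ] E} (hU : IsUnitaryGroup A U) (hU' : IsUnitaryGroup A U') : U = U' := by
  have key : ∀ u ∈ A.domain, ∀ w ∈ A.domain, ∀ t, inner ℂ (U t w) (U' t u) = inner ℂ w u := by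
    intro u hu w hw t
    have gu : (u, A ⟨u, hu⟩) ∈ A.graph := A.mem_graph ⟨u, hu⟩
    have gw : (w, A ⟨w, hw⟩) ∈ A.graph := A.mem_graph ⟨w, hw⟩
    have inv : ∀ (W : ℝ → E →L[ℂ] E), IsUnitaryGroup A W → ∀ (x y : E), (x, y) ∈ A.graph →
        ∀ s, (W s x, W s y) ∈ A.graph := by
      intro W hW x y hxy s
      rw [hW.mem_graph_iff]
      have := hW.hasDerivAt hxy s
      have h3 : HasDerivAt (fun r => W (r + s) x) (Complex.I • W s y) 0 := by
        have h' : HasDerivAt (fun r => W r x) (Complex.I • W s y) (0 + s) := by simpa using this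
        exact h'.comp_add_const 0 s
      simpa [hW.map_add] using h3
    have symm : ∀ x y x' y' : E, (x, y) ∈ A.graph → (x', y') ∈ A.graph →
        inner ℂ x y' = inner ℂ y x' := by
      intro x y x' y' h h'
      have hd := (hU.hasDerivAt h 0).inner ℂ (hU.hasDerivAt h' 0)
      have hc : (fun s => inner ℂ (U s x) (U s x')) = fun _ => inner ℂ x x' := by
        funext s
        exact ContinuousLinearMap.inner_map_map_of_mem_unitary (hU.mem_unitary s) x x'
      rw [hc] at hd
      have := hd.unique (hasDerivAt_const (0 : ℝ) (inner ℂ x x'))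
      simp only [hU.map_zero, one_apply_eq_self, inner_smul_left, inner_smul_right,
        Complex.conj_I] at this
      have h4 : Complex.I * (inner ℂ x y' - inner ℂ y x') = 0 := by linear_combination this
      rcases mul_eq_zero.1 h4 with h5 | h5
      · exact absurd h5 Complex.I_ne_zero
      · exact sub_eq_zero.1 h5
    have hd : ∀ s, HasDerivAt (fun s => inner ℂ (U s w) (U' s u)) 0 s := by
      intro s
      have hd := (hU.hasDerivAt gw s).inner ℂ (hU'.hasDerivAt gu s)
      have h6 := symm _ _ _ _ (inv U hU _ _ gw s) (inv U' hU' _ _ gu s)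
      have e : inner ℂ (U s w) (Complex.I • U' s (A ⟨u, hu⟩)) +
          inner ℂ (Complex.I • U s (A ⟨w, hw⟩)) (U' s u) = 0 := by
        rw [inner_smul_left, inner_smul_right, Complex.conj_I, h6]
        ring
      rwa [e] at hd
    have := is_const_of_deriv_eq_zero (fun s => (hd s).differentiableAt)
      (fun s => (hd s).deriv) t 0
    simpa [hU.map_zero, hU'.map_zero] using this
  funext t
  have key2 : ∀ u w : E, inner ℂ (U t w) (U' t u) = inner ℂ w u := by
    intro u w
    have c1 : ∀ u ∈ A.domain, ∀ w, inner ℂ (U t w) (U' t u) = inner ℂ w u := by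
      intro u hu w
      have := Continuous.ext_on hA (f := fun w => inner ℂ (U t w) (U' t u))
        (g := fun w => inner ℂ w u) (by fun_prop) (by fun_prop) (fun w hw => key u hu w hw t)
      exact congrFun this w
    have := Continuous.ext_on hA (f := fun u => inner ℂ (U t w) (U' t u))
        (g := fun u => inner ℂ w u) (by fun_prop) (by fun_prop) (fun u hu => c1 u hu w)
    exact congrFun this u
  ext u
  have hs : ∀ w, inner ℂ (U t w) (U' t u - U t u) = 0 := by
    intro w
    rw [inner_sub_right, key2,
      ContinuousLinearMap.inner_map_map_of_mem_unitary (hU.mem_unitary t), sub_self]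
  have hsurj : U t (U (-t) (U' t u - U t u)) = U' t u - U t u := by
    have := hU.map_add t (-t)
    rw [add_neg_cancel, hU.map_zero] at this
    exact (congrArg (fun T : E →L[ℂ] E => T (U' t u - U t u)) this).symm
  have := hs (U (-t) (U' t u - U t u))
  rw [hsurj, inner_self_eq_zero, sub_eq_zero] at this
  exact this.symm

/-- `μ` is the spectral measure `⟨u, E_A(·) u⟩` of the self-adjoint operator `A` at the vector `u`:
the finite Borel measure on `ℝ` with `∫ e^{itλ} dμ(λ) = ⟨u, e^{itA} u⟩` for all `t`. (A finite
measure is determined by its characteristic function.) -/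
def IsSpectralMeasureAt (A : E →ₗ.[ℂ] E) (u : E) (μ : Measure ℝ) : Prop :=
  IsFiniteMeasure μ ∧ ∀ t : ℝ, charFun μ t = inner ℂ u (unitaryGroup A t u)

/-- The absolutely continuous spectral subspace of `A`: the vectors whose spectral measure is
absolutely continuous with respect to Lebesgue measure. For a self-adjoint `A` these vectors
already form a closed subspace, so that the span and the closure add nothing. -/
def acSubspace (A : E →ₗ.[ℂ] E) : Submodule ℂ E :=
  (Submodule.span ℂ {u : E | ∃ μ : Measure ℝ,
    IsSpectralMeasureAt A u μ ∧ μ ≪ volume}).topologicalClosure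

/-- `P_ac(A)`, the orthogonal projection onto the absolutely continuous subspace. -/
def acProj (A : E →ₗ.[ℂ] E) : E →L[ℂ] E :=
  haveI : CompleteSpace (acSubspace A) :=
    (Submodule.isClosed_topologicalClosure _).completeSpace_coe
  (acSubspace A).starProjection

end Abstract

/-- The strong limit of the bounded operators `T t` along the filter `l` exists, as a bounded
operator on the normed space `X`. -/
def StrongLimitExists {X : Type*} [NormedAddCommGroup X] [NormedSpace ℂ X]
    (T : ℝ → X →L[ℂ] X) (l : Filter ℝ) : Prop :=
  ∃ W : X →L[ℂ] X, ∀ u, Tendsto (fun t => T t u) l (𝓝 (W u))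

/-! ### `L²`, Sobolev spaces and the operators `Δ²` and `Δ² + V` -/

/-- `L²(ℝⁿ; ℂ)`. -/
abbrev L2 (n : ℕ) : Type :=
  Lp ℂ 2 (volume : Measure (EuclideanSpace ℝ (Fin n)))

section Spaces

variable {n : ℕ}

theorem L2.toTemperedDistribution_injective {u v : L2 n}
    (h : (u : 𝓢'(EuclideanSpace ℝ (Fin n), ℂ)) = v) : u = v := by
  have hk := Lp.ker_toTemperedDistributionCLM_eq_bot (F := ℂ) (p := 2)
    (μ := (volume : Measure (EuclideanSpace ℝ (Fin n))))
  exact LinearMap.ker_eq_bot.1 hk h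

/-- The part in `L²` of an operator `T` on tempered distributions: if `T` maps the subspace `D` of
`L²` into `L²`, this is `T` as a linear map from `D` to `L²`. -/
def partInL2 (T : 𝓢'(EuclideanSpace ℝ (Fin n), ℂ) →ₗ[ℂ] 𝓢'(EuclideanSpace ℝ (Fin n), ℂ))
    (D : Submodule ℂ (L2 n))
    (h : ∀ u ∈ D, ∃ g : L2 n, T (u : 𝓢'(EuclideanSpace ℝ (Fin n), ℂ)) = g) : D →ₗ[ℂ] L2 n where
  toFun u := (h u u.2).choose
  map_add' u v := L2.toTemperedDistribution_injective <| by
    rw [← (h _ (u + v).2).choose_spec, ← Lp.toTemperedDistributionCLM_apply,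
      ← Lp.toTemperedDistributionCLM_apply, map_add]
    simp only [Submodule.coe_add, map_add, Lp.toTemperedDistributionCLM_apply]
    rw [← (h _ u.2).choose_spec, ← (h _ v.2).choose_spec]
  map_smul' c u := L2.toTemperedDistribution_injective <| by
    rw [← (h _ (c • u).2).choose_spec, ← Lp.toTemperedDistributionCLM_apply,
      ← Lp.toTemperedDistributionCLM_apply, map_smul]
    simp only [Submodule.coe_smul, map_smul, Lp.toTemperedDistributionCLM_apply, RingHom.id_apply]
    rw [← (h _ u.2).choose_spec]

theorem partInL2_spec
    (T : 𝓢'(EuclideanSpace ℝ (Fin n), ℂ) →ₗ[ℂ] 𝓢'(EuclideanSpace ℝ (Fin n), ℂ))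
    (D : Submodule ℂ (L2 n))
    (h : ∀ u ∈ D, ∃ g : L2 n, T (u : 𝓢'(EuclideanSpace ℝ (Fin n), ℂ)) = g) (u : D) :
    (partInL2 T D h u : 𝓢'(EuclideanSpace ℝ (Fin n), ℂ)) =
      T ((u : L2 n) : 𝓢'(EuclideanSpace ℝ (Fin n), ℂ)) :=
  (h u u.2).choose_spec.symm

variable (n) in
/-- The Sobolev space `H^s(ℝⁿ)`, `s ≥ 0`, as a subspace of `L²`. -/
def sobolevSubmodule (s : ℝ) : Submodule ℂ (L2 n) where
  carrier := {u | MemSobolev s 2 (u : 𝓢'(EuclideanSpace ℝ (Fin n), ℂ))}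
  add_mem' {u v} hu hv := by
    have := MemSobolev.add hu hv
    rwa [← Lp.toTemperedDistributionCLM_apply, ← Lp.toTemperedDistributionCLM_apply,
      ← map_add] at this
  zero_mem' := by
    have := memSobolev_fun_zero (EuclideanSpace ℝ (Fin n)) ℂ s 2
    rwa [← map_zero (Lp.toTemperedDistributionCLM ℂ volume 2)] at this
  smul_mem' c u hu := by
    have := MemSobolev.smul c hu
    rwa [← Lp.toTemperedDistributionCLM_apply, ← map_smul] at this

variable (n) in
/-- The distributional Laplacian on tempered distributions on `ℝⁿ`. -/
def distLaplacian :
    𝓢'(EuclideanSpace ℝ (Fin n), ℂ) →ₗ[ℂ] 𝓢'(EuclideanSpace ℝ (Fin n), ℂ) :=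
  (LineDeriv.laplacianCLM ℂ (EuclideanSpace ℝ (Fin n))
    𝓢'(EuclideanSpace ℝ (Fin n), ℂ)).toLinearMap

theorem distLaplacian_apply (f : 𝓢'(EuclideanSpace ℝ (Fin n), ℂ)) : distLaplacian n f = Δ f :=
  laplacianCLM_apply f

variable (n) in
/-- `1 - Δ` as a map from `H²` to `L²`. -/
def oneSubLaplacian : sobolevSubmodule n 2 →ₗ[ℂ] L2 n :=
  partInL2 (LinearMap.id - distLaplacian n) (sobolevSubmodule n 2) <| by
    intro u hu
    have h : MemSobolev (2 - 2 : ℝ) 2 (Δ (u : 𝓢'(EuclideanSpace ℝ (Fin n), ℂ))) :=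
      MemSobolev.laplacian hu
    rw [sub_self, memSobolev_zero_iff] at h
    obtain ⟨g, hg⟩ := h
    refine ⟨u - g, ?_⟩
    rw [LinearMap.sub_apply, distLaplacian_apply, hg, ← Lp.toTemperedDistributionCLM_apply,
      ← Lp.toTemperedDistributionCLM_apply, ← Lp.toTemperedDistributionCLM_apply, map_sub]
    rfl

theorem oneSubLaplacian_spec (u : sobolevSubmodule n 2) :
    (oneSubLaplacian n u : 𝓢'(EuclideanSpace ℝ (Fin n), ℂ)) =
      ((u : L2 n) : 𝓢'(EuclideanSpace ℝ (Fin n), ℂ)) -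
        Δ ((u : L2 n) : 𝓢'(EuclideanSpace ℝ (Fin n), ℂ)) := by
  rw [oneSubLaplacian, partInL2_spec, LinearMap.sub_apply, distLaplacian_apply, LinearMap.id_apply]

theorem oneSubLaplacian_injective : Function.Injective (oneSubLaplacian n) := by
  rw [← LinearMap.ker_eq_bot, LinearMap.ker_eq_bot']
  intro u hu
  have h0 : (((u : L2 n) : 𝓢'(EuclideanSpace ℝ (Fin n), ℂ))) -
      Δ ((u : L2 n) : 𝓢'(EuclideanSpace ℝ (Fin n), ℂ)) = 0 := by
    have h := oneSubLaplacian_spec u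
    rw [hu, ← Lp.toTemperedDistributionCLM_apply, map_zero] at h
    exact h.symm
  have hm : 0 < 2 * Real.pi := by positivity
  have tg1 : (fun x : EuclideanSpace ℝ (Fin n) =>
      (((1 + ‖(2 * Real.pi) • x‖ ^ 2) ^ (-1 : ℝ) : ℝ) : ℂ)).HasTemperateGrowth := by
    have hc := (Function.hasTemperateGrowth_one_add_norm_sq_rpow
      (EuclideanSpace ℝ (Fin n)) (-1)).comp
      ((2 * Real.pi) • ContinuousLinearMap.id ℝ (EuclideanSpace ℝ (Fin n))).hasTemperateGrowth
    exact Function.HasTemperateGrowth.comp Function.Complex.hasTemperateGrowth_ofReal hc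
  have tg2 : (fun x : EuclideanSpace ℝ (Fin n) => ((‖x‖ ^ 2 : ℝ) : ℂ)).HasTemperateGrowth :=
    by fun_prop
  have tg3 : (((2 * Real.pi) ^ 2 : ℂ) •
      fun x : EuclideanSpace ℝ (Fin n) => ((‖x‖ ^ 2 : ℝ) : ℂ)).HasTemperateGrowth := by fun_prop
  apply Subtype.ext
  apply L2.toTemperedDistribution_injective
  set f : 𝓢'(EuclideanSpace ℝ (Fin n), ℂ) := ((u : L2 n) : 𝓢'(EuclideanSpace ℝ (Fin n), ℂ))
  have hz : ((((0 : sobolevSubmodule n 2) : L2 n)) : 𝓢'(EuclideanSpace ℝ (Fin n), ℂ)) = 0 := by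
    rw [← Lp.toTemperedDistributionCLM_apply]
    exact map_zero _
  rw [hz]
  have h1 : f + fourierMultiplierCLM ℂ (((2 * Real.pi) ^ 2 : ℂ) •
      fun x : EuclideanSpace ℝ (Fin n) => ((‖x‖ ^ 2 : ℝ) : ℂ)) f = 0 := by
    rw [laplacian_eq_fourierMultiplierCLM] at h0
    rw [fourierMultiplierCLM_smul tg2, ← h0, sub_eq_add_neg, neg_smul, neg_neg]
    congr 1
    rw [← Complex.coe_smul]
    simp
  have h2 := congrArg (fourierMultiplierCLM ℂ (fun x : EuclideanSpace ℝ (Fin n) =>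
      (((1 + ‖(2 * Real.pi) • x‖ ^ 2) ^ (-1 : ℝ) : ℝ) : ℂ))) h1
  rw [map_add, map_zero, fourierMultiplierCLM_fourierMultiplierCLM_apply tg3 tg1] at h2
  have h3 : fourierMultiplierCLM ℂ (fun _ : EuclideanSpace ℝ (Fin n) => (1 : ℂ)) f = f := by simp
  have h4 := fourierMultiplierCLM_sum ℂ (E := EuclideanSpace ℝ (Fin n)) (s := Finset.univ)
    (g := fun i : Fin 2 => if i = 0 then (fun x : EuclideanSpace ℝ (Fin n) =>
      (((1 + ‖(2 * Real.pi) • x‖ ^ 2) ^ (-1 : ℝ) : ℝ) : ℂ)) else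
      ((((2 * Real.pi) ^ 2 : ℂ) • fun x : EuclideanSpace ℝ (Fin n) => ((‖x‖ ^ 2 : ℝ) : ℂ)) *
      (fun x : EuclideanSpace ℝ (Fin n) =>
      (((1 + ‖(2 * Real.pi) • x‖ ^ 2) ^ (-1 : ℝ) : ℝ) : ℂ)))) (by
        intro i _
        split_ifs
        · exact tg1
        · exact tg3.mul tg1)
  simp only [Fin.sum_univ_two, if_true, one_ne_zero, if_false] at h4
  have h5 := congrArg (fun T => T f) h4
  simp only [add_apply] at h5
  rw [h2] at h5
  rw [← h3, ← h5]
  congr 2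
  funext x
  simp only [Pi.mul_apply, Pi.smul_apply, smul_eq_mul, norm_smul, Real.norm_eq_abs,
    abs_of_pos hm]
  have hp : (1 + (2 * Real.pi * ‖x‖) ^ 2 : ℝ) ≠ 0 := by positivity
  rw [Real.rpow_neg_one]
  have hp' : (1 + (2 * Real.pi * ‖x‖) ^ 2 : ℂ) ≠ 0 := by exact_mod_cast hp
  push_cast
  have hi := mul_inv_cancel₀ hp'
  linear_combination -hi

variable (n) in
/-- The Sobolev space `H²(ℝⁿ)` with the norm `‖u‖_{H²} = ‖(1 - Δ) u‖_{L²}`. -/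
def SobolevH2 : Type := sobolevSubmodule n 2

namespace SobolevH2

instance : AddCommGroup (SobolevH2 n) := inferInstanceAs (AddCommGroup (sobolevSubmodule n 2))

instance : Module ℂ (SobolevH2 n) := inferInstanceAs (Module ℂ (sobolevSubmodule n 2))

instance : NormedAddCommGroup (SobolevH2 n) :=
  NormedAddCommGroup.induced (SobolevH2 n) (L2 n)
    (show SobolevH2 n →ₗ[ℂ] L2 n from oneSubLaplacian n) oneSubLaplacian_injective

instance : NormedSpace ℂ (SobolevH2 n) :=
  NormedSpace.induced ℂ (SobolevH2 n) (L2 n)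
    (show SobolevH2 n →ₗ[ℂ] L2 n from oneSubLaplacian n)

/-- The inclusion of `H²` in `L²`. -/
def toL2 : SobolevH2 n →ₗ[ℂ] L2 n := (sobolevSubmodule n 2).subtype

theorem norm_def (u : SobolevH2 n) : ‖u‖ = ‖oneSubLaplacian n u‖ := rfl

end SobolevH2

variable (n) in
/-- `Δ²` as a map from `H⁴` to `L²`. -/
def biLaplacian : sobolevSubmodule n 4 →ₗ[ℂ] L2 n :=
  partInL2 (distLaplacian n ∘ₗ distLaplacian n) (sobolevSubmodule n 4) <| by
    intro u hu
    have h : MemSobolev (4 - 2 - 2 : ℝ) 2 (Δ (Δ (u : 𝓢'(EuclideanSpace ℝ (Fin n), ℂ)))) :=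
      MemSobolev.laplacian (MemSobolev.laplacian hu)
    rw [show (4 - 2 - 2 : ℝ) = 0 by norm_num, memSobolev_zero_iff] at h
    obtain ⟨g, hg⟩ := h
    exact ⟨g, by rw [LinearMap.comp_apply, distLaplacian_apply, distLaplacian_apply, hg]⟩

/-- Multiplication by a real-valued `V ∈ L^∞` on `L²`. -/
def potentialMul (V : Lp ℝ ∞ (volume : Measure (EuclideanSpace ℝ (Fin n)))) :
    L2 n →ₗ[ℂ] L2 n where
  toFun u := (V • u : L2 n)
  map_add' u v := Lp.add_smul V u v
  map_smul' c u := by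
    apply Lp.ext
    filter_upwards [Lp.coeFn_lpSMul (r := 2) V (c • u), Lp.coeFn_lpSMul (r := 2) V u,
      Lp.coeFn_smul c u, Lp.coeFn_smul c (V • u : L2 n)] with x h1 h2 h3 h4
    simp only [RingHom.id_apply, h1, h4, Pi.smul_apply, Pi.smul_apply', h2, h3]
    exact smul_comm _ _ _

variable (n) in
/-- `H₀ = Δ²` as an operator in `L²` with domain `H⁴`. -/
def freeHamiltonian : L2 n →ₗ.[ℂ] L2 n where
  domain := sobolevSubmodule n 4
  toFun := biLaplacian n

/-- `H = Δ² + V` as an operator in `L²` with domain `H⁴`. -/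
def hamiltonian (V : Lp ℝ ∞ (volume : Measure (EuclideanSpace ℝ (Fin n)))) :
    L2 n →ₗ.[ℂ] L2 n where
  domain := sobolevSubmodule n 4
  toFun := biLaplacian n + potentialMul V ∘ₗ (sobolevSubmodule n 4).subtype

/-- `V(x) → 0` as `|x| → ∞`, for a function defined almost everywhere. -/
def VanishesAtInfinity (V : Lp ℝ ∞ (volume : Measure (EuclideanSpace ℝ (Fin n)))) : Prop :=
  ∀ ε : ℝ, 0 < ε → ∃ R : ℝ, ∀ᵐ x : EuclideanSpace ℝ (Fin n), R ≤ ‖x‖ → |V x| ≤ ε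

/-- The operators `e^{itH} e^{-itH₀}`. -/
def waveFamily (V : Lp ℝ ∞ (volume : Measure (EuclideanSpace ℝ (Fin n)))) (t : ℝ) :
    L2 n →L[ℂ] L2 n :=
  unitaryGroup (hamiltonian V) t ∘L unitaryGroup (freeHamiltonian n) (-t)

/-- The operators `e^{itH₀} e^{-itH} P_ac(H)`. -/
def inverseWaveFamily (V : Lp ℝ ∞ (volume : Measure (EuclideanSpace ℝ (Fin n)))) (t : ℝ) :
    L2 n →L[ℂ] L2 n :=
  unitaryGroup (freeHamiltonian n) t ∘L unitaryGroup (hamiltonian V) (-t) ∘L acProj (hamiltonian V)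

/-- The strong limit of `T t` along `l` exists on `H²`: every `T t` restricts to a bounded operator
on `H²`, and these restrictions converge strongly, in the norm of `H²`, to a bounded operator
on `H²`. -/
def StrongLimitExistsOnH2 (T : ℝ → L2 n →L[ℂ] L2 n) (l : Filter ℝ) : Prop :=
  ∃ S : ℝ → SobolevH2 n →L[ℂ] SobolevH2 n,
    (∀ t u, (S t u).toL2 = T t u.toL2) ∧ StrongLimitExists S l

end Spaces

end

/-!
Let `T t` be one of the two families of operators. Each of the operators `e^{itΔ²}`, `e^{itH}` and
`P_ac(H)` is a contraction on `L²` that preserves the graph of `Δ²` or of `H`, and that does not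
increase the associated quadratic form, shifted to be nonnegative. As `H` and `Δ²` differ by a
bounded operator, their graph norms and form norms are equivalent, and these are the norms of `H⁴`
and `H²`. Hence all `T t` are bounded in `H⁴` and in `H²`, uniformly in `t` (`IsSobolevBounded`).

For `u ∈ H⁴` the family `T t u` converges in `L²` and is bounded in `H⁴`, so the interpolation
inequality `‖w‖_{H²} ≤ ‖w‖ + (‖w‖ ‖Δ²w‖)^{1/2}` (`SobolevH2.norm_le_of_mem_graph`) makes it
Cauchy in `H²`. The uniform bound in `H²` and the density of `H⁴` in `H²` extend this to all
`u ∈ H²` (`strongLimitExistsOnH2_of_isSobolevBounded`).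

For the groups `unitaryGroup` to be the intended ones, `Δ²` and `H` have to generate unitary
groups. This is Stone's theorem (`exists_isUnitaryGroup`), proved through Yosida approximation.
Its input is the surjectivity of `Δ² + ik` and `H + ik`. In terms of the Fourier multiplier
`R = (1 - Δ)⁻¹`, whose square has range `H⁴`, one has `(Δ² + ik)R² = (1 - R)² + ikR²`, which is
invertible by spectral mapping; `H + ik` is then onto for `|k| > ‖V‖` by a Neumann series.

The projection `P_ac(H)` commutes with `e^{isH}` because the spectral measures at `u` and
`e^{isH}u` agree, so that it preserves the graph of `H` and splits its quadratic form.
-/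

/-! ### The unitary group generated by a bounded self-adjoint operator -/

section BoundedGenerator

variable {E : Type*} [NormedAddCommGroup E] [InnerProductSpace ℂ E] [CompleteSpace E]

/-- The group `t ↦ e^{itS}` generated by a bounded operator `S`, as a power series. -/
noncomputable def expGroup (S : E →L[ℂ] E) (t : ℝ) : E →L[ℂ] E :=
  NormedSpace.exp (t • (Complex.I • S))

theorem expGroup_zero (S : E →L[ℂ] E) : expGroup S 0 = 1 := by
  simp [expGroup, NormedSpace.exp_zero]

theorem expGroup_add (S : E →L[ℂ] E) (s t : ℝ) :
    expGroup S (s + t) = expGroup S s * expGroup S t := by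
  let : NormedAlgebra ℚ (E →L[ℂ] E) := NormedAlgebra.restrictScalars ℚ ℂ _
  rw [expGroup, add_smul, NormedSpace.exp_add_of_commute]
  · rfl
  · exact ((Commute.refl (Complex.I • S)).smul_left s).smul_right t

theorem expGroup_mem_unitary {S : E →L[ℂ] E} (hS : IsSelfAdjoint S) (t : ℝ) :
    expGroup S t ∈ unitary (E →L[ℂ] E) := by
  have hS' : IsSelfAdjoint (t • S) := by
    rw [IsSelfAdjoint, star_smul, hS.star_eq, star_trivial]
  have h : (selfAdjoint.expUnitary (⟨t • S, hS'⟩ :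
      selfAdjoint (E →L[ℂ] E)) : E →L[ℂ] E) = expGroup S t := by
    rw [selfAdjoint.expUnitary_coe, expGroup, smul_comm]
  rw [← h]
  exact Subtype.property _

theorem norm_map_of_mem_unitary {T : E →L[ℂ] E} (hT : T ∈ unitary (E →L[ℂ] E)) (u : E) :
    ‖T u‖ = ‖u‖ := by
  have h := ContinuousLinearMap.inner_map_map_of_mem_unitary hT u u
  rw [inner_self_eq_norm_sq_to_K, inner_self_eq_norm_sq_to_K] at h
  norm_cast at h
  exact (pow_left_inj₀ (norm_nonneg _) (norm_nonneg _) two_ne_zero).1 h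

theorem hasDerivAt_expGroup_apply (S : E →L[ℂ] E) (u : E) (t : ℝ) :
    HasDerivAt (fun s => expGroup S s u) (expGroup S t (Complex.I • S u)) t := by
  have h := hasDerivAt_exp_smul_const (𝕂 := ℝ) (Complex.I • S) t
  exact ((ContinuousLinearMap.apply ℂ E u).restrictScalars ℝ).hasFDerivAt.comp_hasDerivAt t h

theorem norm_expGroup_apply_sub_le {S : E →L[ℂ] E} (hS : IsSelfAdjoint S) (u : E) (s t : ℝ) :
    ‖expGroup S t u - expGroup S s u‖ ≤ ‖S u‖ * |t - s| := by
  have h := Convex.norm_image_sub_le_of_norm_hasDerivWithin_le (s := Set.univ) (C := ‖S u‖)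
    (f := fun s => expGroup S s u) (x := s) (y := t)
    (fun r _ => (hasDerivAt_expGroup_apply S u r).hasDerivWithinAt)
    (fun r _ => by
      rw [norm_map_of_mem_unitary (expGroup_mem_unitary hS r), norm_smul]
      simp) convex_univ (Set.mem_univ _) (Set.mem_univ _)
  simpa using h

/-- For commuting generators the difference of the two groups is controlled by the difference of
the generators. -/
theorem norm_expGroup_sub_expGroup_apply_le {S T : E →L[ℂ] E} (hS : IsSelfAdjoint S)
    (hT : IsSelfAdjoint T) (hST : Commute S T) (u : E) (t : ℝ) :
    ‖expGroup S t u - expGroup T t u‖ ≤ ‖S u - T u‖ * |t| := by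
  let : NormedAlgebra ℚ (E →L[ℂ] E) := NormedAlgebra.restrictScalars ℚ ℂ _
  have hc : Commute (t • (Complex.I • T)) (t • (Complex.I • (S - T))) :=
    (((((hST.symm.sub_right (Commute.refl T)).smul_left Complex.I).smul_right Complex.I).smul_left
      t).smul_right t)
  have h : expGroup S t = expGroup T t * expGroup (S - T) t := by
    rw [expGroup, expGroup, expGroup, ← NormedSpace.exp_add_of_commute hc, ← smul_add, ← smul_add,
      add_sub_cancel]
  have h2 : expGroup S t u - expGroup T t u =
      expGroup T t (expGroup (S - T) t u - expGroup (S - T) 0 u) := by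
    rw [h, expGroup_zero, map_sub]
    rfl
  rw [h2, norm_map_of_mem_unitary (expGroup_mem_unitary hT t)]
  simpa using norm_expGroup_apply_sub_le (hS.sub hT) u 0 t

end BoundedGenerator

/-! ### Resolvents of a symmetric operator -/

section Resolvent

variable {E : Type*} [NormedAddCommGroup E] [InnerProductSpace ℂ E]
  {A : E →ₗ.[ℂ] E}

theorem LinearPMap.IsFormalAdjoint.inner_of_mem_graph (hA : A.IsFormalAdjoint A) {u v u' v' : E}
    (h : (u, v) ∈ A.graph) (h' : (u', v') ∈ A.graph) : inner ℂ v u' = inner ℂ u v' := by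
  rw [LinearPMap.mem_graph_iff] at h h'
  obtain ⟨x, rfl, rfl⟩ := h
  obtain ⟨y, rfl, rfl⟩ := h'
  exact hA x y

/-- `‖(A + ik)u‖² = ‖Au‖² + k²‖u‖²` for symmetric `A` and real `k`. -/
theorem LinearPMap.IsFormalAdjoint.norm_sq_add_I_smul (hA : A.IsFormalAdjoint A) {u v : E}
    (h : (u, v) ∈ A.graph) (k : ℝ) :
    ‖v + (Complex.I * k) • u‖ ^ 2 = ‖v‖ ^ 2 + k ^ 2 * ‖u‖ ^ 2 := by
  have h1 : (inner ℂ v u).im = 0 := by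
    have h2 := hA.inner_of_mem_graph h h
    have h3 := inner_conj_symm (𝕜 := ℂ) u v
    rw [← h2] at h3
    exact Complex.conj_eq_iff_im.1 h3
  rw [norm_add_sq (𝕜 := ℂ), inner_smul_right, norm_smul]
  simp [h1, mul_pow]

theorem LinearPMap.IsFormalAdjoint.abs_mul_norm_le (hA : A.IsFormalAdjoint A) {u v : E}
    (h : (u, v) ∈ A.graph) (k : ℝ) : |k| * ‖u‖ ≤ ‖v + (Complex.I * k) • u‖ := by
  refine le_of_sq_le_sq ?_ (norm_nonneg _)
  rw [hA.norm_sq_add_I_smul h, mul_pow, sq_abs]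
  nlinarith [sq_nonneg ‖v‖]

/-- The bounded operator `J` is the resolvent `(A + ik)⁻¹`. -/
structure IsResolventAt (A : E →ₗ.[ℂ] E) (k : ℝ) (J : E →L[ℂ] E) : Prop where
  mem_graph : ∀ f, (J f, f - (Complex.I * k) • J f) ∈ A.graph

theorem IsResolventAt.norm_apply_le (hA : A.IsFormalAdjoint A) {k : ℝ} {J : E →L[ℂ] E}
    (hJ : IsResolventAt A k J) (f : E) : |k| * ‖J f‖ ≤ ‖f‖ := by
  simpa using hA.abs_mul_norm_le (hJ.mem_graph f) k

theorem IsResolventAt.eq_of_mem_graph (hA : A.IsFormalAdjoint A) {k : ℝ} (hk : k ≠ 0)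
    {J : E →L[ℂ] E} (hJ : IsResolventAt A k J) {u v : E} (h : (u, v) ∈ A.graph) :
    u = J (v + (Complex.I * k) • u) := by
  have h1 := hA.abs_mul_norm_le (A.graph.sub_mem h (hJ.mem_graph (v + (Complex.I * k) • u))) k
  have h2 : v - (v + (Complex.I * k) • u - (Complex.I * k) • J (v + (Complex.I * k) • u)) +
      (Complex.I * k) • (u - J (v + (Complex.I * k) • u)) = 0 := by
    rw [smul_sub]
    abel
  rw [h2, norm_zero] at h1
  have h3 : 0 < |k| := abs_pos.2 hk
  have h4 := norm_nonneg (u - J (v + (Complex.I * k) • u))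
  exact sub_eq_zero.1 (norm_eq_zero.1 (by nlinarith))

theorem exists_isResolventAt (hA : A.IsFormalAdjoint A) {k : ℝ} (hk : k ≠ 0)
    (h : ∀ f, ∃ u v, (u, v) ∈ A.graph ∧ v + (Complex.I * k) • u = f) :
    ∃ J, IsResolventAt A k J := by
  choose R B hRB hR using h
  have inj : ∀ {u v f}, (u, v) ∈ A.graph → v + (Complex.I * k) • u = f → u = R f := by
    intro u v f huv hf
    have h1 := hA.abs_mul_norm_le (A.graph.sub_mem huv (hRB f)) k
    have h2 : (v - B f) + (Complex.I * k) • (u - R f) = 0 := by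
      rw [smul_sub, ← sub_eq_zero.2 (hf.trans (hR f).symm)]
      abel
    rw [h2, norm_zero] at h1
    have h3 : 0 < |k| := abs_pos.2 hk
    have h4 := norm_nonneg (u - R f)
    exact sub_eq_zero.1 (norm_eq_zero.1 (by nlinarith))
  let L : E →ₗ[ℂ] E :=
    { toFun := R
      map_add' := fun f g => (inj (A.graph.add_mem (hRB f) (hRB g)) (by
        conv_rhs => rw [← hR f, ← hR g]
        simp only [smul_add]
        abel)).symm
      map_smul' := fun c f => (inj (A.graph.smul_mem c (hRB f)) (by
        conv_rhs => rw [← hR f]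
        simp only [smul_add]
        rw [smul_comm])).symm }
  refine ⟨L.mkContinuous |k|⁻¹ fun f => ?_, ⟨fun f => ?_⟩⟩
  · have h1 := hA.abs_mul_norm_le (hRB f) k
    rw [hR] at h1
    have h3 : 0 < |k| := abs_pos.2 hk
    rw [inv_mul_eq_div, le_div_iff₀ h3, mul_comm]
    exact h1
  · have h1 : f - (Complex.I * k) • R f = B f := by
      conv_lhs => rw [← hR f]
      abel_nf
      simp [hR]
    change (R f, f - (Complex.I * k) • R f) ∈ A.graph
    rw [h1]
    exact hRB f

theorem IsResolventAt.inner_apply (hA : A.IsFormalAdjoint A) {k : ℝ}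
    {J J' : E →L[ℂ] E} (hJ : IsResolventAt A k J) (hJ' : IsResolventAt A (-k) J') (f g : E) :
    inner ℂ (J f) g = inner ℂ f (J' g) := by
  have h := hA.inner_of_mem_graph (hJ.mem_graph f) (hJ'.mem_graph g)
  rw [inner_sub_left, inner_sub_right, inner_smul_left, inner_smul_right] at h
  simp only [map_mul, Complex.conj_I, Complex.conj_ofReal, Complex.ofReal_neg] at h
  linear_combination -h

/-- The first resolvent identity. -/
theorem IsResolventAt.sub_eq (hA : A.IsFormalAdjoint A) {k l : ℝ} (hl : l ≠ 0)
    {J K : E →L[ℂ] E} (hJ : IsResolventAt A k J) (hK : IsResolventAt A l K) :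
    J = K + (Complex.I * (l - k)) • (K * J) := by
  ext f
  have h := hK.eq_of_mem_graph hA hl (hJ.mem_graph f)
  rw [show f - (Complex.I * k) • J f + (Complex.I * l) • J f =
    f + (Complex.I * (l - k)) • J f by module, map_add, map_smul] at h
  exact h

theorem IsResolventAt.commute (hA : A.IsFormalAdjoint A) {k l : ℝ} (hk : k ≠ 0) (hl : l ≠ 0)
    {J K : E →L[ℂ] E} (hJ : IsResolventAt A k J) (hK : IsResolventAt A l K) : Commute J K := by
  rcases eq_or_ne k l with rfl | h
  · have h1 := hJ.sub_eq hA hk hK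
    simp only [sub_self, mul_zero, zero_smul, add_zero] at h1
    rw [h1]
  · have h1 := hJ.sub_eq hA hl hK
    have h2 := hK.sub_eq hA hk hJ
    have h3 : (Complex.I * (l - k)) • (K * J - J * K) = 0 := by
      calc (Complex.I * (l - k)) • (K * J - J * K)
          = (Complex.I * (l - k)) • (K * J) + (Complex.I * (k - l)) • (J * K) := by module
        _ = (J - K) + (K - J) := by rw [sub_eq_of_eq_add' h1, sub_eq_of_eq_add' h2]
        _ = 0 := by abel
    have h5 : Complex.I * ((l : ℂ) - k) ≠ 0 :=
      mul_ne_zero Complex.I_ne_zero (sub_ne_zero.2 (by exact_mod_cast h.symm))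
    exact (sub_eq_zero.1 ((smul_eq_zero.1 h3).resolve_left h5)).symm

end Resolvent

/-! ### Strong limits of equibounded operators -/

section StrongLimits

variable {ι X Y : Type*} [NormedAddCommGroup X] [NormedSpace ℂ X] [NormedAddCommGroup Y]
  [NormedSpace ℂ Y]

theorem cauchy_map_apply_of_dense {T : ι → X →L[ℂ] Y} {l : Filter ι} {C : ℝ}
    (hT : ∀ i u, ‖T i u‖ ≤ C * ‖u‖) {s : Set X} (hs : Dense s)
    (h : ∀ u ∈ s, Cauchy (map (fun i => T i u) l)) (u : X) : Cauchy (map (fun i => T i u) l) := by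
  obtain ⟨u₀, hu₀⟩ := hs.nonempty
  have hl : l.NeBot := (h u₀ hu₀).1.of_map
  refine Metric.cauchy_iff.2 ⟨hl.map _, fun ε hε => ?_⟩
  have hC : 0 < |C| + 1 := by positivity
  obtain ⟨v, hv, hvu⟩ := Metric.dense_iff.1 hs u (ε / 4 / (|C| + 1)) (by positivity)
  obtain ⟨t, ht, htε⟩ := (Metric.cauchy_iff.1 (h v hvu)).2 (ε / 2) (by positivity)
  have hd : ∀ i, dist (T i u) (T i v) < ε / 4 := fun i => by
    rw [dist_eq_norm, ← map_sub]
    rw [Metric.mem_ball, dist_comm, dist_eq_norm, lt_div_iff₀ hC] at hv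
    have h1 := hT i (u - v)
    have h2 := le_abs_self C
    nlinarith [norm_nonneg (u - v)]
  refine ⟨(fun i => T i u) '' {i | T i v ∈ t}, image_mem_map ht, ?_⟩
  rintro _ ⟨i, hi, rfl⟩ _ ⟨j, hj, rfl⟩
  have h1 := htε _ hi _ hj
  have h2 := hd i
  have h3 := hd j
  rw [dist_comm] at h3
  calc dist (T i u) (T j u) ≤ dist (T i u) (T i v) + dist (T i v) (T j v) + dist (T j v) (T j u) :=
        dist_triangle4 _ _ _ _
    _ < ε := by linarith

/-- An equibounded family of operators that converges pointwise on a dense set converges strongly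
to a bounded operator. -/
theorem exists_tendsto_apply_of_dense [CompleteSpace Y] {T : ι → X →L[ℂ] Y} {l : Filter ι} {C : ℝ}
    (hT : ∀ i u, ‖T i u‖ ≤ C * ‖u‖) {s : Set X} (hs : Dense s)
    (h : ∀ u ∈ s, Cauchy (map (fun i => T i u) l)) :
    ∃ W : X →L[ℂ] Y, ∀ u, Tendsto (fun i => T i u) l (𝓝 (W u)) := by
  obtain ⟨u₀, hu₀⟩ := hs.nonempty
  have hl : l.NeBot := (h u₀ hu₀).1.of_map
  have hlim : ∀ u, ∃ v, Tendsto (fun i => T i u) l (𝓝 v) := fun u =>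
    CompleteSpace.complete (cauchy_map_apply_of_dense hT hs h u)
  choose W hW using hlim
  let L : X →ₗ[ℂ] Y :=
    { toFun := W
      map_add' := fun u v => tendsto_nhds_unique (hW (u + v)) (by
        simpa using (hW u).add (hW v))
      map_smul' := fun c u => tendsto_nhds_unique (hW (c • u)) (by
        simpa using (hW u).const_smul c) }
  exact ⟨L.mkContinuous C fun u =>
    le_of_tendsto (hW u).norm (Eventually.of_forall fun i => hT i u), hW⟩

theorem tendsto_apply_of_dense [CompleteSpace Y] {T : ι → X →L[ℂ] Y} {l : Filter ι} [l.NeBot]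
    {C : ℝ} (hT : ∀ i u, ‖T i u‖ ≤ C * ‖u‖) {s : Set X} (hs : Dense s) {W : X →L[ℂ] Y}
    (h : ∀ u ∈ s, Tendsto (fun i => T i u) l (𝓝 (W u))) (u : X) :
    Tendsto (fun i => T i u) l (𝓝 (W u)) := by
  obtain ⟨W', hW'⟩ := exists_tendsto_apply_of_dense hT hs fun u hu => (h u hu).cauchy_map
  have h1 := Continuous.ext_on hs W'.continuous W.continuous fun u hu =>
    tendsto_nhds_unique (hW' u) (h u hu)
  rw [← congrFun h1 u]
  exact hW' u

end StrongLimits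

/-! ### Stone's theorem through Yosida approximation -/

section Stone

variable {E : Type*} [NormedAddCommGroup E] [InnerProductSpace ℂ E] [CompleteSpace E]
  {A : E →ₗ.[ℂ] E}

theorem IsResolventAt.dense_domain (hA : A.IsFormalAdjoint A) {k : ℝ} (hk : k ≠ 0)
    {J : E →L[ℂ] E} (hJ : IsResolventAt A k J) : Dense (A.domain : Set E) := by
  rw [Submodule.dense_iff_topologicalClosure_eq_top,
    Submodule.topologicalClosure_eq_top_iff, Submodule.eq_bot_iff]
  intro f hf
  have hmem := hJ.mem_graph f
  have h1 : inner ℂ (J f) f = 0 := hf (J f) (A.mem_domain_of_mem_graph hmem)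
  have h2 := hA.inner_of_mem_graph hmem hmem
  have h3 : inner ℂ f (J f) = 0 := inner_eq_zero_symm.1 h1
  rw [inner_sub_left, inner_sub_right, inner_smul_left, inner_smul_right, h1, h3] at h2
  simp only [map_mul, Complex.conj_I, Complex.conj_ofReal] at h2
  have h4 : Complex.I * k * inner ℂ (J f) (J f) = 0 := by linear_combination h2 / 2
  have h5 : J f = 0 := by
    rcases mul_eq_zero.1 h4 with h | h
    · exact absurd h (mul_ne_zero Complex.I_ne_zero (by exact_mod_cast hk))
    · exact inner_self_eq_zero.1 h
  rw [h5, smul_zero, sub_zero] at hmem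
  exact A.graph_fst_eq_zero_snd hmem rfl

/-- The Yosida approximation `(k²/2)((A + ik)⁻¹ + (A - ik)⁻¹) = k² A (A² + k²)⁻¹` of `A`. -/
noncomputable def yosida (k : ℝ) (J J' : E →L[ℂ] E) : E →L[ℂ] E :=
  ((k ^ 2 / 2 : ℝ) : ℂ) • (J + J')

theorem isSelfAdjoint_yosida (hA : A.IsFormalAdjoint A) {k : ℝ} {J J' : E →L[ℂ] E}
    (hJ : IsResolventAt A k J) (hJ' : IsResolventAt A (-k) J') :
    IsSelfAdjoint (yosida k J J') := by
  rw [ContinuousLinearMap.isSelfAdjoint_iff_isSymmetric]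
  intro f g
  have h1 := hJ.inner_apply hA hJ' f g
  have h2 := hJ.inner_apply hA hJ' g f
  have h3 : inner ℂ (J' f) g = inner ℂ f (J g) := by
    rw [← inner_conj_symm, ← h2, inner_conj_symm]
  simp only [yosida, ContinuousLinearMap.coe_coe, smul_apply, add_apply, inner_smul_left,
    inner_smul_right, inner_add_left, inner_add_right, h1, h3, Complex.conj_ofReal]
  ring

variable {κ : ℕ → ℝ} {J J' : ℕ → E →L[ℂ] E}

theorem tendsto_I_mul_smul_resolvent (hA : A.IsFormalAdjoint A) (hκ : ∀ m, κ m ≠ 0)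
    (hκ' : Tendsto (fun m => |κ m|) atTop atTop) (hJ : ∀ m, IsResolventAt A (κ m) (J m)) (f : E) :
    Tendsto (fun m => (Complex.I * κ m) • J m f) atTop (𝓝 f) := by
  have hb : ∀ m u, ‖((Complex.I * κ m) • J m) u‖ ≤ 1 * ‖u‖ := fun m u => by
    simpa [norm_smul] using (hJ m).norm_apply_le hA u
  refine tendsto_apply_of_dense (T := fun m => (Complex.I * κ m) • J m) hb
    ((hJ 0).dense_domain hA (hκ 0)) (W := ContinuousLinearMap.id ℂ E) (fun u hu => ?_) f
  have hg := A.mem_graph ⟨u, hu⟩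
  have he : ∀ m, (Complex.I * κ m) • J m u = u - J m (A ⟨u, hu⟩) := fun m => by
    have h := (hJ m).eq_of_mem_graph hA (hκ m) hg
    rw [map_add, map_smul] at h
    exact (sub_eq_of_eq_add' h).symm
  have h0 : Tendsto (fun m => J m (A ⟨u, hu⟩)) atTop (𝓝 0) := by
    refine squeeze_zero_norm (fun m => ?_) (tendsto_const_nhds.div_atTop hκ' :
      Tendsto (fun m => ‖A ⟨u, hu⟩‖ / |κ m|) atTop (𝓝 0))
    rw [le_div_iff₀ (abs_pos.2 (hκ m)), mul_comm]
    exact (hJ m).norm_apply_le hA _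
  have h1 := tendsto_const_nhds (x := u) |>.sub h0
  rw [sub_zero] at h1
  exact h1.congr fun m => (he m).symm

theorem tendsto_yosida_apply (hA : A.IsFormalAdjoint A) (hκ : ∀ m, κ m ≠ 0)
    (hκ' : Tendsto (fun m => |κ m|) atTop atTop) (hJ : ∀ m, IsResolventAt A (κ m) (J m))
    (hJ' : ∀ m, IsResolventAt A (-κ m) (J' m)) {u v : E} (h : (u, v) ∈ A.graph) :
    Tendsto (fun m => yosida (κ m) (J m) (J' m) u) atTop (𝓝 v) := by
  have h1 := tendsto_I_mul_smul_resolvent hA hκ hκ' hJ v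
  have h2 := tendsto_I_mul_smul_resolvent (κ := fun m => -κ m) hA (fun m => neg_ne_zero.2 (hκ m))
    (by simpa using hκ') hJ' v
  have h3 := (h1.add h2).const_smul (1 / 2 : ℂ)
  rw [← two_smul ℂ v, smul_smul] at h3
  norm_num at h3
  refine h3.congr fun m => ?_
  have e1 := (hJ m).eq_of_mem_graph hA (hκ m) h
  have e2 := (hJ' m).eq_of_mem_graph hA (neg_ne_zero.2 (hκ m)) h
  rw [map_add, map_smul] at e1 e2
  push_cast at e2
  have e3 : (Complex.I * κ m) • u = (Complex.I * κ m) • J m v - ((κ m : ℂ) ^ 2) • J m u := by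
    conv_lhs => rw [e1]
    rw [smul_add, smul_smul, mul_mul_mul_comm, Complex.I_mul_I]
    module
  have e4 : (Complex.I * κ m) • u = (Complex.I * κ m) • J' m v + ((κ m : ℂ) ^ 2) • J' m u := by
    conv_lhs => rw [e2]
    rw [smul_add, smul_smul, mul_neg, mul_neg, mul_mul_mul_comm, Complex.I_mul_I]
    module
  have e5 : ((κ m : ℂ) ^ 2) • J m u + ((κ m : ℂ) ^ 2) • J' m u =
      (Complex.I * κ m) • J m v - (Complex.I * κ m) • J' m v := by
    rw [eq_sub_of_add_eq' e4.symm, ← sub_eq_zero]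
    have := sub_eq_zero.2 e3
    rw [← this]
    abel
  simp only [yosida, smul_apply, add_apply]
  push_cast
  rw [show ((κ m : ℂ) ^ 2 / 2) • (J m u + J' m u) = (1 / 2 : ℂ) •
    (((κ m : ℂ) ^ 2) • J m u + ((κ m : ℂ) ^ 2) • J' m u) by module, e5]
  module

omit [CompleteSpace E] in
/-- If the generator of a group of isometries extends `A`, and `A + ik` is onto for some real
`k ≠ 0`, then the generator is `A`, because the generator plus `ik` is injective. -/
theorem mem_graph_of_hasDerivAt {k : ℝ} (hk : k ≠ 0) {J : E →L[ℂ] E}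
    (hJ : IsResolventAt A k J) {U : ℝ → E →L[ℂ] E} (hU : ∀ t u, ‖U t u‖ = ‖u‖)
    (hU0 : U 0 = 1) (hd : ∀ u v, (u, v) ∈ A.graph →
      HasDerivAt (fun t => U t u) (Complex.I • v) 0) {u v : E}
    (h : HasDerivAt (fun t => U t u) (Complex.I • v) 0) : (u, v) ∈ A.graph := by
  have hw := hJ.mem_graph (v + (Complex.I * k) • u)
  set w := J (v + (Complex.I * k) • u)
  have h1 := h.sub (hd _ _ hw)
  have h2 : HasDerivAt (fun t => U t (u - w)) (((k : ℝ) : ℂ) • (u - w)) 0 := by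
    convert h1 using 1
    · funext t
      simp
    · rw [← smul_sub, show v - (v + (Complex.I * k) • u - (Complex.I * k) • w) =
        (-(Complex.I * k)) • (u - w) by module, smul_smul]
      congr 1
      linear_combination (k : ℂ) * Complex.I_mul_I
  have h3 := h2.inner ℂ h2
  have h4 : (fun t => inner ℂ (U t (u - w)) (U t (u - w))) = fun _ => inner ℂ (u - w) (u - w) := by
    funext t
    rw [inner_self_eq_norm_sq_to_K, inner_self_eq_norm_sq_to_K, hU]
  rw [h4] at h3
  have h5 := h3.unique (hasDerivAt_const (0 : ℝ) _)
  simp only [hU0, one_apply_eq_self, inner_smul_left, inner_smul_right, Complex.conj_ofReal] at h5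
  have h6 : (k : ℂ) * inner ℂ (u - w) (u - w) = 0 := by linear_combination h5 / 2
  have h7 : u = w := by
    rcases mul_eq_zero.1 h6 with h | h
    · exact absurd h (by exact_mod_cast hk)
    · exact sub_eq_zero.1 (inner_self_eq_zero.1 h)
  rw [← h7, add_sub_cancel_right] at hw
  exact hw

/-- **Stone's theorem**, existence: a symmetric operator `A` for which `A + ik` is onto for all
real `k` of large modulus generates a unitary group. -/
theorem exists_isUnitaryGroup (hA : A.IsFormalAdjoint A) {c : ℝ}
    (hres : ∀ k : ℝ, c < |k| → ∃ J, IsResolventAt A k J) : ∃ U, IsUnitaryGroup A U := by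
  let κ : ℕ → ℝ := fun m => |c| + 1 + m
  have hκ : ∀ m, 0 < κ m := fun m => by positivity
  have hκc : ∀ m, c < |κ m| := fun m => by
    rw [abs_of_pos (hκ m)]
    have h1 := le_abs_self c
    have h2 : (0 : ℝ) ≤ m := m.cast_nonneg
    simp only [κ]
    linarith
  have hκ' : Tendsto (fun m => |κ m|) atTop atTop :=
    tendsto_abs_atTop_atTop.comp
      (tendsto_atTop_add_const_left _ _ tendsto_natCast_atTop_atTop)
  choose J hJ using fun m => hres (κ m) (hκc m)
  choose J' hJ' using fun m => hres (-κ m) (by rw [abs_neg]; exact hκc m)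
  let Y : ℕ → E →L[ℂ] E := fun m => yosida (κ m) (J m) (J' m)
  have hY : ∀ m, IsSelfAdjoint (Y m) := fun m => isSelfAdjoint_yosida hA (hJ m) (hJ' m)
  have hYlim : ∀ {u v : E}, (u, v) ∈ A.graph → Tendsto (fun m => Y m u) atTop (𝓝 v) :=
    fun h => tendsto_yosida_apply hA (fun m => (hκ m).ne') hκ' hJ hJ' h
  have hcomm : ∀ m p, Commute (Y m) (Y p) := fun m p => by
    have n1 := (hκ m).ne'
    have n2 := (hκ p).ne'
    refine (Commute.smul_left ?_ _).smul_right _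
    exact ((IsResolventAt.commute hA n1 n2 (hJ m) (hJ p)).add_right
      (IsResolventAt.commute hA n1 (neg_ne_zero.2 n2) (hJ m) (hJ' p))).add_left
      ((IsResolventAt.commute hA (neg_ne_zero.2 n1) n2 (hJ' m) (hJ p)).add_right
      (IsResolventAt.commute hA (neg_ne_zero.2 n1) (neg_ne_zero.2 n2) (hJ' m) (hJ' p)))
  have hdense : Dense (A.domain : Set E) := (hJ 0).dense_domain hA (hκ 0).ne'
  have hun : ∀ m t u, ‖expGroup (Y m) t u‖ = ‖u‖ := fun m t =>
    norm_map_of_mem_unitary (expGroup_mem_unitary (hY m) t)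
  have hex : ∀ t, ∃ W : E →L[ℂ] E, ∀ u,
      Tendsto (fun m => expGroup (Y m) t u) atTop (𝓝 (W u)) := fun t => by
    refine exists_tendsto_apply_of_dense (C := 1) (fun m u => by rw [hun, one_mul]) hdense
      fun u hu => ?_
    have hc : CauchySeq fun m => Y m u := (hYlim (A.mem_graph ⟨u, hu⟩)).cauchySeq
    change CauchySeq fun m => expGroup (Y m) t u
    rw [Metric.cauchySeq_iff] at hc ⊢
    intro ε hε
    obtain ⟨N, hN⟩ := hc (ε / (|t| + 1)) (by positivity)
    refine ⟨N, fun m hm p hp => ?_⟩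
    have h1 := hN m hm p hp
    rw [dist_eq_norm, lt_div_iff₀ (by positivity)] at h1
    rw [dist_eq_norm]
    have h2 := norm_expGroup_sub_expGroup_apply_le (hY m) (hY p) (hcomm m p) u t
    nlinarith [norm_nonneg (Y m u - Y p u)]
  choose U hU using hex
  have hnorm : ∀ t u, ‖U t u‖ = ‖u‖ := fun t u =>
    tendsto_nhds_unique (hU t u).norm (by simp only [hun]; exact tendsto_const_nhds)
  have hU0 : U 0 = 1 := by
    ext u
    exact tendsto_nhds_unique (hU 0 u) (by simp only [expGroup_zero]; exact tendsto_const_nhds)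
  have hadd : ∀ s t, U (s + t) = U s ∘L U t := fun s t => by
    ext u
    refine tendsto_nhds_unique (hU (s + t) u) ?_
    have h1 : Tendsto (fun m => expGroup (Y m) s (expGroup (Y m) t u - U t u)) atTop (𝓝 0) := by
      rw [tendsto_zero_iff_norm_tendsto_zero]
      simp only [hun]
      simpa using ((hU t u).sub_const (U t u)).norm
    have h2 := h1.add (hU s (U t u))
    rw [zero_add] at h2
    refine h2.congr fun m => ?_
    rw [map_sub, sub_add_cancel, expGroup_add]
    rfl
  -- Lipschitz on the domain, uniformly in the approximation, hence continuous by density.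
  have hcont : ∀ u, Continuous fun t => U t u := fun u => by
    have hb : ∀ t v, ‖U t v‖ ≤ 1 * ‖v‖ := fun t v => by rw [hnorm, one_mul]
    refine continuous_iff_continuousAt.2 fun s =>
      tendsto_apply_of_dense hb hdense (fun u hu => ?_) u
    have hg := A.mem_graph ⟨u, hu⟩
    have hlip : ∀ t, ‖U t u - U s u‖ ≤ ‖A ⟨u, hu⟩‖ * |t - s| := fun t =>
      le_of_tendsto_of_tendsto' ((hU t u).sub (hU s u)).norm
        ((hYlim hg).norm.mul_const _) fun m => norm_expGroup_apply_sub_le (hY m) u s t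
    rw [tendsto_iff_norm_sub_tendsto_zero]
    refine squeeze_zero (fun t => norm_nonneg _) hlip ?_
    have hc : Continuous fun t : ℝ => ‖A ⟨u, hu⟩‖ * |t - s| := by fun_prop
    simpa using hc.tendsto s
  -- The derivative at `0` is read off from the integrated equation, which passes to the limit.
  have hderiv : ∀ u v, (u, v) ∈ A.graph →
      HasDerivAt (fun t => U t u) (Complex.I • v) 0 := fun u v h => by
    have hint : ∀ t, U t u = u + ∫ s in (0 : ℝ)..t, U s (Complex.I • v) := fun t => by
      have h1 : ∀ m, expGroup (Y m) t u = u +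
          ∫ s in (0 : ℝ)..t, expGroup (Y m) s (Complex.I • Y m u) := fun m => by
        have hc : Continuous fun s => expGroup (Y m) s (Complex.I • Y m u) :=
          continuous_iff_continuousAt.2 fun s =>
            (hasDerivAt_expGroup_apply (Y m) (Complex.I • Y m u) s).continuousAt
        rw [intervalIntegral.integral_eq_sub_of_hasDerivAt
          (fun s _ => hasDerivAt_expGroup_apply (Y m) u s) (hc.intervalIntegrable _ _),
          expGroup_zero]
        simp
      obtain ⟨B, hB⟩ := (hYlim h).norm.bddAbove_range
      refine tendsto_nhds_unique (hU t u) ?_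
      simp only [h1]
      refine tendsto_const_nhds.add ?_
      refine intervalIntegral.tendsto_integral_filter_of_dominated_convergence (fun _ => B)
        (Eventually.of_forall fun m => ?_) (Eventually.of_forall fun m => ?_)
        intervalIntegrable_const (Eventually.of_forall fun s _ => ?_)
      · exact (continuous_iff_continuousAt.2 fun s =>
          (hasDerivAt_expGroup_apply (Y m) (Complex.I • Y m u) s).continuousAt).aestronglyMeasurable
      · refine Eventually.of_forall fun s _ => ?_
        rw [hun, norm_smul, Complex.norm_I, one_mul]
        exact hB ⟨m, rfl⟩
      · have h2 : Tendsto (fun m => expGroup (Y m) s (Complex.I • Y m u - Complex.I • v)) atTop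
            (𝓝 0) := by
          rw [tendsto_zero_iff_norm_tendsto_zero]
          simp only [hun, ← smul_sub, norm_smul, Complex.norm_I, one_mul]
          simpa using ((hYlim h).sub_const v).norm
        have h3 := h2.add (hU s (Complex.I • v))
        rw [zero_add] at h3
        exact h3.congr fun m => by rw [map_sub, sub_add_cancel]
    have h4 := (intervalIntegral.integral_hasDerivAt_right
      ((hcont (Complex.I • v)).intervalIntegrable 0 0)
      (hcont (Complex.I • v)).aestronglyMeasurable.stronglyMeasurableAtFilter
      (hcont (Complex.I • v)).continuousAt).const_add u
    simp only [hU0, one_apply_eq_self] at h4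
    convert h4 using 1
    funext t
    exact hint t
  refine ⟨U, hU0, hadd, fun t => ?_, hcont, fun u v => ⟨hderiv u v, fun h =>
    mem_graph_of_hasDerivAt (hκ 0).ne' (hJ 0) hnorm hU0 hderiv h⟩⟩
  have hstar : ∀ t, star (U t) * U t = 1 := fun t =>
    (ContinuousLinearMap.norm_map_iff_adjoint_comp_self (U t)).1 (hnorm t)
  refine Unitary.mem_iff.2 ⟨hstar t, ?_⟩
  have h1 : U t * U (-t) = 1 := by
    rw [← hU0, ← add_neg_cancel t, hadd]
    rfl
  have h2 : star (U t) = U (-t) := by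
    rw [← mul_one (star (U t)), ← h1, ← mul_assoc, hstar, one_mul]
  rw [h2, h1]

end Stone

/-! ### Multiplication by bounded real functions -/

section Multiplication

variable {n : ℕ}

/-- Multiplication by `V ∈ L^∞` as a bounded operator on `L²`. -/
noncomputable def potentialMulCLM (V : Lp ℝ ∞ (volume : Measure (EuclideanSpace ℝ (Fin n)))) :
    L2 n →L[ℂ] L2 n :=
  (potentialMul V).mkContinuous ‖V‖ fun u => Lp.norm_smul_le V u

theorem norm_potentialMul_le (V : Lp ℝ ∞ (volume : Measure (EuclideanSpace ℝ (Fin n))))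
    (u : L2 n) : ‖potentialMul V u‖ ≤ ‖V‖ * ‖u‖ := Lp.norm_smul_le V u

theorem inner_potentialMul (V : Lp ℝ ∞ (volume : Measure (EuclideanSpace ℝ (Fin n))))
    (u v : L2 n) : inner ℂ (potentialMul V u) v = inner ℂ u (potentialMul V v) := by
  rw [L2.inner_def, L2.inner_def]
  refine integral_congr_ae ?_
  filter_upwards [Lp.coeFn_lpSMul (r := 2) V u, Lp.coeFn_lpSMul (r := 2) V v] with x h1 h2
  change inner ℂ ((V • u : L2 n) x) (v x) = inner ℂ (u x) ((V • v : L2 n) x)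
  rw [h1, h2, Pi.smul_apply', Pi.smul_apply', ← Complex.coe_smul, ← Complex.coe_smul, inner_smul_left,
    inner_smul_right, Complex.conj_ofReal]

end Multiplication

/-! ### The operator `(1 - Δ)⁻¹` on `L²` -/

section Resolvent

variable {n : ℕ}

variable (n) in
/-- The symbol `(1 + 4π²‖ξ‖²)⁻¹` of `(1 - Δ)⁻¹`. -/
noncomputable def resolventSymbol (x : EuclideanSpace ℝ (Fin n)) : ℝ := (1 + ‖(2 * Real.pi) • x‖ ^ 2) ^ (-1 : ℝ)

theorem hasTemperateGrowth_resolventSymbol : (resolventSymbol n).HasTemperateGrowth :=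
  (Function.hasTemperateGrowth_one_add_norm_sq_rpow (EuclideanSpace ℝ (Fin n)) (-1)).comp
    ((2 * Real.pi) • ContinuousLinearMap.id ℝ (EuclideanSpace ℝ (Fin n))).hasTemperateGrowth

theorem hasTemperateGrowth_resolventSymbol_ofReal :
    (fun x => (resolventSymbol n x : ℂ)).HasTemperateGrowth :=
  Function.HasTemperateGrowth.comp Function.Complex.hasTemperateGrowth_ofReal
    hasTemperateGrowth_resolventSymbol

theorem resolventSymbol_pos (x : EuclideanSpace ℝ (Fin n)) : 0 < resolventSymbol n x := by
  unfold resolventSymbol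
  positivity

theorem resolventSymbol_mul (x : EuclideanSpace ℝ (Fin n)) :
    resolventSymbol n x * (1 + (2 * Real.pi) ^ 2 * ‖x‖ ^ 2) = 1 := by
  have h : ‖(2 * Real.pi) • x‖ ^ 2 = (2 * Real.pi) ^ 2 * ‖x‖ ^ 2 := by
    rw [norm_smul, mul_pow, Real.norm_eq_abs, sq_abs]
  rw [resolventSymbol, Real.rpow_neg_one, h]
  exact inv_mul_cancel₀ (by positivity)

theorem resolventSymbol_mul_le (x : EuclideanSpace ℝ (Fin n)) :
    resolventSymbol n x * (1 + ‖x‖ ^ 2) ≤ 1 := by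
  refine le_of_le_of_eq ?_ (resolventSymbol_mul x)
  refine mul_le_mul_of_nonneg_left ?_ (resolventSymbol_pos x).le
  have h1 : (1 : ℝ) ≤ (2 * Real.pi) ^ 2 := by nlinarith [Real.pi_gt_three]
  nlinarith [sq_nonneg ‖x‖]

theorem resolventSymbol_le_one (x : EuclideanSpace ℝ (Fin n)) : resolventSymbol n x ≤ 1 := by
  nlinarith [resolventSymbol_mul_le x, resolventSymbol_pos x, sq_nonneg ‖x‖]

theorem norm_resolventSymbol_le (x : EuclideanSpace ℝ (Fin n)) : ‖resolventSymbol n x‖ ≤ 1 := by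
  rw [Real.norm_eq_abs, abs_of_pos (resolventSymbol_pos x)]
  exact resolventSymbol_le_one x

theorem memLp_resolventSymbol : MemLp (resolventSymbol n) ∞ volume :=
  memLp_top_of_bound hasTemperateGrowth_resolventSymbol.1.continuous.aestronglyMeasurable 1
    (Eventually.of_forall norm_resolventSymbol_le)

variable (n) in
/-- The bounded inverse `(1 - Δ)⁻¹` of `1 - Δ` on `L²`, as a Fourier multiplier. -/
noncomputable def oneSubLaplacianInv : L2 n →L[ℂ] L2 n :=
  ((Lp.fourierTransformₗᵢ (EuclideanSpace ℝ (Fin n)) ℂ).symm : L2 n →L[ℂ] L2 n) ∘L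
    potentialMulCLM memLp_resolventSymbol.toLp ∘L
    (Lp.fourierTransformₗᵢ (EuclideanSpace ℝ (Fin n)) ℂ : L2 n →L[ℂ] L2 n)

theorem norm_oneSubLaplacianInv_apply_le (f : L2 n) : ‖oneSubLaplacianInv n f‖ ≤ ‖f‖ := by
  have h1 : ‖(memLp_resolventSymbol (n := n)).toLp‖ ≤ 1 := by
    rw [Lp.norm_toLp]
    refine ENNReal.toReal_le_of_le_ofReal zero_le_one ?_
    rw [eLpNorm_exponent_top]
    exact eLpNormEssSup_le_of_ae_bound (Eventually.of_forall norm_resolventSymbol_le)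
  set F := Lp.fourierTransformₗᵢ (EuclideanSpace ℝ (Fin n)) ℂ
  change ‖F.symm (potentialMul memLp_resolventSymbol.toLp (F f))‖ ≤ _
  rw [LinearIsometryEquiv.norm_map]
  refine (norm_potentialMul_le _ _).trans ?_
  rw [LinearIsometryEquiv.norm_map]
  exact mul_le_of_le_one_left (norm_nonneg _) h1

theorem inner_oneSubLaplacianInv (f g : L2 n) :
    inner ℂ (oneSubLaplacianInv n f) g = inner ℂ f (oneSubLaplacianInv n g) := by
  set F := Lp.fourierTransformₗᵢ (EuclideanSpace ℝ (Fin n)) ℂ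
  change inner ℂ (F.symm (potentialMul memLp_resolventSymbol.toLp (F f))) g =
    inner ℂ f (F.symm (potentialMul memLp_resolventSymbol.toLp (F g)))
  rw [← F.inner_map_map, F.apply_symm_apply, inner_potentialMul, ← F.inner_map_map f,
    F.apply_symm_apply]

theorem coe_oneSubLaplacianInv (f : L2 n) :
    (oneSubLaplacianInv n f : 𝓢'(EuclideanSpace ℝ (Fin n), ℂ)) =
      fourierMultiplierCLM ℂ (fun x => (resolventSymbol n x : ℂ))
        (f : 𝓢'(EuclideanSpace ℝ (Fin n), ℂ)) := by
  have h1 : ((memLp_resolventSymbol (n := n)).toLp • FourierTransform.fourier f : L2 n) =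
      ((memLp_resolventSymbol (n := n)).ofReal (K := ℂ)).toLp • FourierTransform.fourier f := by
    apply Lp.ext
    filter_upwards [Lp.coeFn_lpSMul (r := 2) (memLp_resolventSymbol (n := n)).toLp
      (FourierTransform.fourier f : L2 n),
      Lp.coeFn_lpSMul (r := 2) ((memLp_resolventSymbol (n := n)).ofReal (K := ℂ)).toLp
      (FourierTransform.fourier f : L2 n), (memLp_resolventSymbol (n := n)).coeFn_toLp,
      ((memLp_resolventSymbol (n := n)).ofReal (K := ℂ)).coeFn_toLp] with x h1 h2 h3 h4
    rw [h1, h2, Pi.smul_apply', Pi.smul_apply', h3, h4]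
    exact (Complex.coe_smul _ _).symm
  rw [fourierMultiplierCLM_apply, Lp.fourier_toTemperedDistribution_eq,
    ← Lp.toTemperedDistribution_smul_eq (q := 2) (r := 2) hasTemperateGrowth_resolventSymbol_ofReal
      ((memLp_resolventSymbol (n := n)).ofReal (K := ℂ)),
    Lp.fourierInv_toTemperedDistribution_eq]
  exact congrArg (fun g : L2 n => ((FourierTransformInv.fourierInv g : L2 n) :
    𝓢'(EuclideanSpace ℝ (Fin n), ℂ))) h1

theorem sub_laplacian_eq_fourierMultiplierCLM (T : 𝓢'(EuclideanSpace ℝ (Fin n), ℂ)) :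
    T - Δ T = fourierMultiplierCLM ℂ (fun x : EuclideanSpace ℝ (Fin n) =>
      ((1 + (2 * Real.pi) ^ 2 * ‖x‖ ^ 2 : ℝ) : ℂ)) T := by
  have h2 : (fun x : EuclideanSpace ℝ (Fin n) => ((‖x‖ ^ 2 : ℝ) : ℂ)).HasTemperateGrowth := by
    fun_prop
  have h4 := fourierMultiplierCLM_sum ℂ (E := EuclideanSpace ℝ (Fin n)) (s := Finset.univ)
    (g := fun i : Fin 2 => if i = 0 then (fun _ : EuclideanSpace ℝ (Fin n) => (1 : ℂ)) else
      (((2 * Real.pi) ^ 2 : ℂ) • fun x : EuclideanSpace ℝ (Fin n) => ((‖x‖ ^ 2 : ℝ) : ℂ))) (by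
        intro i _
        split_ifs <;> fun_prop)
  simp only [Fin.sum_univ_two, if_true, one_ne_zero, if_false, Pi.smul_apply, smul_eq_mul] at h4
  have h5 := congrArg (fun S => S T) h4
  simp only [add_apply, fourierMultiplierCLM_smul h2, fourierMultiplierCLM_const, one_smul,
    ContinuousLinearMap.id_apply, smul_apply] at h5
  rw [laplacian_eq_fourierMultiplierCLM, neg_smul, sub_neg_eq_add]
  convert h5.symm using 2
  · rw [← Complex.coe_smul]
    simp
  · congr 1
    funext x
    push_cast
    ring

/-- `(1 - Δ)⁻¹` gains two derivatives. -/
theorem memSobolev_oneSubLaplacianInv {s : ℝ} {f : L2 n}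
    (hf : MemSobolev s 2 (f : 𝓢'(EuclideanSpace ℝ (Fin n), ℂ))) :
    MemSobolev (2 + s) 2 (oneSubLaplacianInv n f : 𝓢'(EuclideanSpace ℝ (Fin n), ℂ)) := by
  have h2 : (fun x : EuclideanSpace ℝ (Fin n) =>
      (((1 + ‖x‖ ^ 2) ^ ((2 : ℝ) / 2) : ℝ) : ℂ)).HasTemperateGrowth := by fun_prop
  rw [← memSobolev_besselPotential_iff, coe_oneSubLaplacianInv, besselPotential,
    fourierMultiplierCLM_fourierMultiplierCLM_apply hasTemperateGrowth_resolventSymbol_ofReal h2]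
  refine hf.fourierMultiplierCLM_of_bounded
    (hasTemperateGrowth_resolventSymbol_ofReal.mul h2) ⟨1, fun x => ?_⟩
  rw [Pi.mul_apply, ← Complex.ofReal_mul, Complex.norm_real, div_self two_ne_zero, Real.rpow_one,
    Real.norm_eq_abs, abs_of_nonneg (mul_nonneg (resolventSymbol_pos x).le (by positivity))]
  exact resolventSymbol_mul_le x

theorem oneSubLaplacianInv_mem (f : L2 n) : oneSubLaplacianInv n f ∈ sobolevSubmodule n 2 := by
  have h := memSobolev_oneSubLaplacianInv (memSobolev_zero_iff.2 ⟨f, rfl⟩)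
  rwa [add_zero] at h

theorem oneSubLaplacianInv_mem_four {f : L2 n} (hf : f ∈ sobolevSubmodule n 2) :
    oneSubLaplacianInv n f ∈ sobolevSubmodule n 4 := by
  have h := memSobolev_oneSubLaplacianInv (s := 2) hf
  rwa [show (2 + 2 : ℝ) = 4 by norm_num] at h

theorem laplacian_oneSubLaplacianInv (f : L2 n) :
    Δ (oneSubLaplacianInv n f : 𝓢'(EuclideanSpace ℝ (Fin n), ℂ)) =
      ((oneSubLaplacianInv n f - f : L2 n) : 𝓢'(EuclideanSpace ℝ (Fin n), ℂ)) := by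
  have h := sub_laplacian_eq_fourierMultiplierCLM
    (oneSubLaplacianInv n f : 𝓢'(EuclideanSpace ℝ (Fin n), ℂ))
  nth_rewrite 3 [coe_oneSubLaplacianInv] at h
  rw [fourierMultiplierCLM_fourierMultiplierCLM_apply hasTemperateGrowth_resolventSymbol_ofReal
    (by fun_prop)] at h
  have h1 : ((fun x => (resolventSymbol n x : ℂ)) * fun x : EuclideanSpace ℝ (Fin n) =>
      ((1 + (2 * Real.pi) ^ 2 * ‖x‖ ^ 2 : ℝ) : ℂ)) = fun _ => 1 := by
    funext x
    rw [Pi.mul_apply, ← Complex.ofReal_mul, resolventSymbol_mul, Complex.ofReal_one]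
  rw [h1, fourierMultiplierCLM_const, one_smul, ContinuousLinearMap.id_apply] at h
  rw [← Lp.toTemperedDistributionCLM_apply (f := oneSubLaplacianInv n f - f), map_sub,
    Lp.toTemperedDistributionCLM_apply, Lp.toTemperedDistributionCLM_apply, ← h]
  abel

theorem oneSubLaplacian_oneSubLaplacianInv (f : L2 n) :
    oneSubLaplacian n ⟨oneSubLaplacianInv n f, oneSubLaplacianInv_mem f⟩ = f := by
  apply L2.toTemperedDistribution_injective
  rw [oneSubLaplacian_spec, laplacian_oneSubLaplacianInv,
    ← Lp.toTemperedDistributionCLM_apply (f := oneSubLaplacianInv n f - f), map_sub,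
    Lp.toTemperedDistributionCLM_apply, Lp.toTemperedDistributionCLM_apply]
  abel

theorem oneSubLaplacianInv_oneSubLaplacian (u : sobolevSubmodule n 2) :
    oneSubLaplacianInv n (oneSubLaplacian n u) = u :=
  congrArg Subtype.val (oneSubLaplacian_injective
    (oneSubLaplacian_oneSubLaplacianInv (oneSubLaplacian n u)))

theorem oneSubLaplacianInv_injective : Function.Injective (oneSubLaplacianInv n) := fun f g h => by
  rw [← oneSubLaplacian_oneSubLaplacianInv f, ← oneSubLaplacian_oneSubLaplacianInv g]
  congr 2

theorem sobolevSubmodule_four_le : sobolevSubmodule n 4 ≤ sobolevSubmodule n 2 := fun _ hu =>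
  MemSobolev.mono (by norm_num) hu

/-- Every element of `H⁴` is `(1 - Δ)⁻² g` for some `g ∈ L²`. -/
theorem exists_oneSubLaplacianInv_sq_eq {u : L2 n} (hu : u ∈ sobolevSubmodule n 4) :
    ∃ g, u = oneSubLaplacianInv n (oneSubLaplacianInv n g) := by
  have h2 := sobolevSubmodule_four_le hu
  have h1 := oneSubLaplacianInv_oneSubLaplacian ⟨u, h2⟩
  have hm : oneSubLaplacian n ⟨u, h2⟩ ∈ sobolevSubmodule n 2 := by
    have h3 : MemSobolev (4 - 2 : ℝ) 2 (Δ (u : 𝓢'(EuclideanSpace ℝ (Fin n), ℂ))) :=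
      MemSobolev.laplacian hu
    rw [show (4 - 2 : ℝ) = 2 by norm_num] at h3
    change MemSobolev 2 2 (oneSubLaplacian n ⟨u, h2⟩ : 𝓢'(EuclideanSpace ℝ (Fin n), ℂ))
    rw [oneSubLaplacian_spec]
    exact MemSobolev.sub h2 h3
  exact ⟨oneSubLaplacian n ⟨_, hm⟩, by rw [oneSubLaplacianInv_oneSubLaplacian ⟨_, hm⟩, h1]⟩

theorem oneSubLaplacianInv_sq_mem (g : L2 n) :
    oneSubLaplacianInv n (oneSubLaplacianInv n g) ∈ sobolevSubmodule n 4 :=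
  oneSubLaplacianInv_mem_four (oneSubLaplacianInv_mem g)

theorem biLaplacian_oneSubLaplacianInv_sq (g : L2 n) :
    biLaplacian n ⟨oneSubLaplacianInv n (oneSubLaplacianInv n g), oneSubLaplacianInv_sq_mem g⟩ =
      oneSubLaplacianInv n (oneSubLaplacianInv n g) - (2 : ℂ) • oneSubLaplacianInv n g + g := by
  apply L2.toTemperedDistribution_injective
  have h : Δ (Δ (oneSubLaplacianInv n (oneSubLaplacianInv n g) :
      𝓢'(EuclideanSpace ℝ (Fin n), ℂ))) =
      ((oneSubLaplacianInv n (oneSubLaplacianInv n g) - oneSubLaplacianInv n g -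
        (oneSubLaplacianInv n g - g) : L2 n) : 𝓢'(EuclideanSpace ℝ (Fin n), ℂ)) := by
    rw [laplacian_oneSubLaplacianInv, ← map_sub, laplacian_oneSubLaplacianInv, map_sub]
  rw [biLaplacian, partInL2_spec, LinearMap.comp_apply, distLaplacian_apply, distLaplacian_apply, h]
  congr 1
  module

end Resolvent

/-! ### The Hamiltonians and their resolvents -/

section Hamiltonian

variable {n : ℕ}

theorem mem_graph_freeHamiltonian_iff {u v : L2 n} :
    (u, v) ∈ (freeHamiltonian n).graph ↔
      ∃ g, u = oneSubLaplacianInv n (oneSubLaplacianInv n g) ∧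
        v = oneSubLaplacianInv n (oneSubLaplacianInv n g) - (2 : ℂ) • oneSubLaplacianInv n g + g := by
  rw [LinearPMap.mem_graph_iff]
  constructor
  · rintro ⟨⟨x, hx⟩, rfl, rfl⟩
    obtain ⟨g, rfl⟩ := exists_oneSubLaplacianInv_sq_eq hx
    exact ⟨g, rfl, biLaplacian_oneSubLaplacianInv_sq g⟩
  · rintro ⟨g, rfl, rfl⟩
    exact ⟨⟨_, oneSubLaplacianInv_sq_mem g⟩, rfl, biLaplacian_oneSubLaplacianInv_sq g⟩

theorem mem_graph_hamiltonian_iff {V : Lp ℝ ∞ (volume : Measure (EuclideanSpace ℝ (Fin n)))}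
    {u v : L2 n} : (u, v) ∈ (hamiltonian V).graph ↔
      (u, v - potentialMul V u) ∈ (freeHamiltonian n).graph := by
  rw [LinearPMap.mem_graph_iff, LinearPMap.mem_graph_iff]
  constructor
  · rintro ⟨x, rfl, rfl⟩
    exact ⟨x, rfl, (add_sub_cancel_right (biLaplacian n x) (potentialMul V x)).symm⟩
  · rintro ⟨x, rfl, h⟩
    exact ⟨x, rfl, (sub_eq_iff_eq_add.1 h.symm).symm⟩

theorem isFormalAdjoint_freeHamiltonian :
    (freeHamiltonian n).IsFormalAdjoint (freeHamiltonian n) := fun x y => by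
  obtain ⟨g, hg, hg'⟩ := mem_graph_freeHamiltonian_iff.1 ((freeHamiltonian n).mem_graph x)
  obtain ⟨f, hf, hf'⟩ := mem_graph_freeHamiltonian_iff.1 ((freeHamiltonian n).mem_graph y)
  rw [hg', hf', hg, hf]
  simp only [inner_add_left, inner_add_right, inner_sub_left, inner_sub_right, inner_smul_left,
    inner_smul_right, inner_oneSubLaplacianInv, map_ofNat]

theorem isFormalAdjoint_hamiltonian (V : Lp ℝ ∞ (volume : Measure (EuclideanSpace ℝ (Fin n)))) :
    (hamiltonian V).IsFormalAdjoint (hamiltonian V) := fun x y => by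
  have hx := mem_graph_hamiltonian_iff.1 ((hamiltonian V).mem_graph x)
  have hy := mem_graph_hamiltonian_iff.1 ((hamiltonian V).mem_graph y)
  have h := isFormalAdjoint_freeHamiltonian.inner_of_mem_graph hx hy
  rw [inner_sub_left, inner_sub_right, inner_potentialMul] at h
  exact sub_left_injective h

/-- By spectral mapping, as `(1 - z)² + ikz²` does not vanish for real `z`. The case of interest is
`R = (1 - Δ)⁻¹`, for which this operator is `(Δ² + ik)R²`. -/
theorem isUnit_one_sub_sq_add {R : L2 n →L[ℂ] L2 n} (hR : IsSelfAdjoint R) {k : ℝ} (hk : k ≠ 0) :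
    IsUnit ((1 - R) ^ 2 + (Complex.I * k) • R ^ 2) := by
  open Polynomial in
  let p : ℂ[X] := (1 - X) ^ 2 + C (Complex.I * k) * X ^ 2
  have hp : aeval R p = (1 - R) ^ 2 + (Complex.I * k) • R ^ 2 := by
    simp [p, Algebra.smul_def]
  have hk' : (1 : ℂ) + Complex.I * k ≠ 0 := fun h => by
    have := congrArg Complex.re h
    simp at this
  have hdeg : 0 < p.degree := by
    rw [← natDegree_pos_iff_degree_pos]
    have h2 : p.coeff 2 ≠ 0 := by
      have : p = C (1 + Complex.I * k) * X ^ 2 + C (-2) * X + 1 := by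
        simp only [p, map_add, map_neg, map_one, C_ofNat]
        ring
      rw [this]
      simp only [coeff_add, coeff_C_mul, coeff_X_pow, coeff_X, coeff_one]
      simpa using hk'
    have := le_natDegree_of_ne_zero h2
    omega
  rw [← hp, ← spectrum.zero_notMem_iff ℂ, spectrum.map_polynomial_aeval_of_degree_pos _ _ hdeg]
  rintro ⟨z, hz, h0⟩
  have hz' := hR.mem_spectrum_eq_re hz
  rw [hz'] at h0
  have h1 : ((1 : ℂ) - z.re) ^ 2 + Complex.I * k * z.re ^ 2 = 0 := by simpa [p] using h0
  have him := congrArg Complex.im h1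
  have hre := congrArg Complex.re h1
  norm_cast at him hre
  simp [pow_two] at him hre
  simp [him.resolve_left hk] at hre

theorem exists_isResolventAt_freeHamiltonian {k : ℝ} (hk : k ≠ 0) :
    ∃ J, IsResolventAt (freeHamiltonian n) k J := by
  refine exists_isResolventAt isFormalAdjoint_freeHamiltonian hk fun f => ?_
  have hR : IsSelfAdjoint (oneSubLaplacianInv n) := by
    rw [ContinuousLinearMap.isSelfAdjoint_iff_isSymmetric]
    exact inner_oneSubLaplacianInv
  obtain ⟨P, hP⟩ := isUnit_one_sub_sq_add hR hk
  let g : L2 n := (↑P⁻¹ : L2 n →L[ℂ] L2 n) f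
  refine ⟨_, _, mem_graph_freeHamiltonian_iff.2 ⟨g, rfl, rfl⟩, ?_⟩
  have h1 : (P : L2 n →L[ℂ] L2 n) g = f := by
    change ((P : L2 n →L[ℂ] L2 n) * (↑P⁻¹ : L2 n →L[ℂ] L2 n)) f = f
    rw [Units.mul_inv]
    rfl
  rw [hP] at h1
  simp only [pow_two, add_apply, smul_apply, mul_apply_eq_comp, sub_apply, one_apply_eq_self,
    map_sub] at h1
  conv_rhs => rw [← h1]
  module

theorem exists_isResolventAt_hamiltonian
    (V : Lp ℝ ∞ (volume : Measure (EuclideanSpace ℝ (Fin n)))) {k : ℝ} (hk : ‖V‖ < |k|) :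
    ∃ J, IsResolventAt (hamiltonian V) k J := by
  have hk0 : 0 < |k| := (norm_nonneg V).trans_lt hk
  refine exists_isResolventAt (isFormalAdjoint_hamiltonian V) (abs_pos.1 hk0) fun f => ?_
  obtain ⟨J, hJ⟩ := exists_isResolventAt_freeHamiltonian (n := n) (abs_pos.1 hk0)
  let T : L2 n →L[ℂ] L2 n := -(potentialMulCLM V ∘L J)
  have hT : ‖T‖ < 1 := by
    refine lt_of_le_of_lt (ContinuousLinearMap.opNorm_le_bound _ (by positivity) fun u => ?_)
      ((div_lt_one hk0).2 hk)
    have h1 := hJ.norm_apply_le isFormalAdjoint_freeHamiltonian u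
    change ‖-potentialMul V (J u)‖ ≤ _
    rw [norm_neg, div_mul_eq_mul_div, le_div_iff₀ hk0]
    have h2 := norm_potentialMul_le V (J u)
    nlinarith [norm_nonneg V]
  obtain ⟨P, hP⟩ := isUnit_one_sub_of_norm_lt_one hT
  let g : L2 n := (↑P⁻¹ : L2 n →L[ℂ] L2 n) f
  have h1 : (P : L2 n →L[ℂ] L2 n) g = f := by
    change ((P : L2 n →L[ℂ] L2 n) * (↑P⁻¹ : L2 n →L[ℂ] L2 n)) f = f
    rw [Units.mul_inv]
    rfl
  rw [hP] at h1
  have h2 : g + potentialMul V (J g) = f := by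
    rw [← h1]
    exact (sub_neg_eq_add g _).symm
  refine ⟨J g, g - (Complex.I * k) • J g + potentialMul V (J g), ?_, ?_⟩
  · rw [mem_graph_hamiltonian_iff, add_sub_cancel_right]
    exact hJ.mem_graph g
  · rw [← h2]
    abel

theorem isUnitaryGroup_unitaryGroup {E : Type*} [NormedAddCommGroup E] [InnerProductSpace ℂ E]
    [CompleteSpace E] {A : E →ₗ.[ℂ] E} (h : ∃ U, IsUnitaryGroup A U) :
    IsUnitaryGroup A (unitaryGroup A) := by
  rw [unitaryGroup, dif_pos h]
  exact h.choose_spec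

theorem isUnitaryGroup_hamiltonian
    (V : Lp ℝ ∞ (volume : Measure (EuclideanSpace ℝ (Fin n)))) :
    IsUnitaryGroup (hamiltonian V) (unitaryGroup (hamiltonian V)) :=
  isUnitaryGroup_unitaryGroup (exists_isUnitaryGroup (isFormalAdjoint_hamiltonian V)
    fun _ hk => exists_isResolventAt_hamiltonian V hk)

end Hamiltonian

/-! ### The absolutely continuous projection commutes with the group -/

section AbsolutelyContinuous

variable {E : Type*} [NormedAddCommGroup E] [InnerProductSpace ℂ E] [CompleteSpace E]
  {A : E →ₗ.[ℂ] E}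

theorem IsUnitaryGroup.apply_neg_apply {U : ℝ → E →L[ℂ] E} (hU : IsUnitaryGroup A U) (t : ℝ)
    (u : E) : U t (U (-t) u) = u := by
  have h := hU.map_add t (-t)
  rw [add_neg_cancel, hU.map_zero] at h
  exact (congrArg (fun T : E →L[ℂ] E => T u) h).symm

theorem IsUnitaryGroup.mem_graph_apply {U : ℝ → E →L[ℂ] E} (hU : IsUnitaryGroup A U) {u v : E}
    (h : (u, v) ∈ A.graph) (t : ℝ) : (U t u, U t v) ∈ A.graph := by
  rw [hU.mem_graph_iff]
  have h1 : HasDerivAt (fun r => U r u) (Complex.I • U t v) (0 + t) := by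
    simpa using hU.hasDerivAt h t
  simpa [hU.map_add] using h1.comp_add_const 0 t

/-- The spectral measures of `A` at `u` and at `e^{isA} u` coincide. -/
theorem unitaryGroup_apply_mem_acSubspace (hU : IsUnitaryGroup A (unitaryGroup A)) (s : ℝ) {u : E}
    (hu : u ∈ acSubspace A) : unitaryGroup A s u ∈ acSubspace A := by
  refine map_mem_closure (unitaryGroup A s).continuous hu fun v hv => ?_
  change v ∈ Submodule.span ℂ _ at hv
  change _ ∈ Submodule.span ℂ _
  induction hv using Submodule.span_induction with
  | zero => rw [map_zero]; exact Submodule.zero_mem _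
  | add x y _ _ hx hy => rw [map_add]; exact Submodule.add_mem _ hx hy
  | smul c x _ hx => rw [map_smul]; exact Submodule.smul_mem _ c hx
  | mem x hx =>
    obtain ⟨μ, ⟨hμ, hμ'⟩, hac⟩ := hx
    refine Submodule.subset_span ⟨μ, ⟨hμ, fun t => ?_⟩, hac⟩
    have h1 : unitaryGroup A t (unitaryGroup A s x) = unitaryGroup A s (unitaryGroup A t x) := by
      rw [← ContinuousLinearMap.comp_apply, ← hU.map_add, add_comm, hU.map_add]
      rfl
    rw [hμ' t, h1, ContinuousLinearMap.inner_map_map_of_mem_unitary (hU.mem_unitary s)]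

/-- `P_ac(A)` as the projection onto a closed subspace. -/
theorem exists_acProj_eq (A : E →ₗ.[ℂ] E) : ∃ _ : (acSubspace A).HasOrthogonalProjection,
    acProj A = (acSubspace A).starProjection :=
  haveI : CompleteSpace (acSubspace A) :=
    (Submodule.isClosed_topologicalClosure _).completeSpace_coe
  ⟨inferInstance, rfl⟩

theorem norm_acProj_apply_le (A : E →ₗ.[ℂ] E) (u : E) : ‖acProj A u‖ ≤ ‖u‖ := by
  obtain ⟨_, h⟩ := exists_acProj_eq A
  rw [h]
  exact (acSubspace A).norm_starProjection_apply_le u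

theorem inner_acProj_sub_acProj (A : E →ₗ.[ℂ] E) (u v : E) :
    inner ℂ (acProj A u) (v - acProj A v) = 0 := by
  obtain ⟨_, h⟩ := exists_acProj_eq A
  rw [h]
  exact (acSubspace A).sub_starProjection_mem_orthogonal v _
    ((acSubspace A).starProjection_apply_mem u)

theorem acProj_unitaryGroup_apply (hU : IsUnitaryGroup A (unitaryGroup A)) (s : ℝ) (u : E) :
    acProj A (unitaryGroup A s u) = unitaryGroup A s (acProj A u) := by
  obtain ⟨_, h⟩ := exists_acProj_eq A
  rw [h]
  refine Submodule.eq_starProjection_of_mem_orthogonal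
    (unitaryGroup_apply_mem_acSubspace hU s ((acSubspace A).starProjection_apply_mem u)) ?_
  rw [← map_sub]
  intro w hw
  have h1 := (acSubspace A).sub_starProjection_mem_orthogonal u _
    (unitaryGroup_apply_mem_acSubspace hU (-s) hw)
  rw [← ContinuousLinearMap.inner_map_map_of_mem_unitary (hU.mem_unitary s),
    hU.apply_neg_apply] at h1
  exact h1

theorem acProj_mem_graph (hU : IsUnitaryGroup A (unitaryGroup A)) {u v : E}
    (h : (u, v) ∈ A.graph) : (acProj A u, acProj A v) ∈ A.graph := by
  rw [hU.mem_graph_iff] at h ⊢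
  have h1 := ((acProj A).restrictScalars ℝ).hasFDerivAt.comp_hasDerivAt (0 : ℝ) h
  convert h1 using 1
  · funext t
    exact (acProj_unitaryGroup_apply hU t u).symm
  · exact (map_smul (acProj A) Complex.I v).symm

end AbsolutelyContinuous

/-! ### The Hilbert space `H²` -/

section SobolevH2

variable {n : ℕ}

variable (n) in
/-- `1 - Δ` as an isometry of `H²` onto `L²`. -/
noncomputable def SobolevH2.isometryEquiv : SobolevH2 n ≃ₗᵢ[ℂ] L2 n where
  toLinearEquiv := LinearEquiv.ofBijective
    (show SobolevH2 n →ₗ[ℂ] L2 n from oneSubLaplacian n)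
    ⟨oneSubLaplacian_injective, fun f => ⟨_, oneSubLaplacian_oneSubLaplacianInv f⟩⟩
  norm_map' _ := rfl

instance : CompleteSpace (SobolevH2 n) :=
  (SobolevH2.isometryEquiv n).toIsometryEquiv.completeSpace

theorem SobolevH2.toL2_injective : Function.Injective (SobolevH2.toL2 (n := n)) :=
  Subtype.val_injective

theorem SobolevH2.exists_toL2_eq {u : L2 n} (hu : u ∈ sobolevSubmodule n 2) :
    ∃ x : SobolevH2 n, x.toL2 = u := ⟨⟨u, hu⟩, rfl⟩

theorem SobolevH2.toL2_eq (x : SobolevH2 n) :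
    x.toL2 = oneSubLaplacianInv n (SobolevH2.isometryEquiv n x) :=
  (oneSubLaplacianInv_oneSubLaplacian x).symm

theorem SobolevH2.norm_toL2_le (x : SobolevH2 n) : ‖x.toL2‖ ≤ ‖x‖ := by
  rw [x.toL2_eq, ← (SobolevH2.isometryEquiv n).norm_map]
  exact norm_oneSubLaplacianInv_apply_le _

theorem SobolevH2.continuous_toL2 : Continuous (SobolevH2.toL2 (n := n)) :=
  AddMonoidHomClass.continuous_of_bound _ 1 fun x => by
    rw [one_mul]
    exact x.norm_toL2_le

theorem denseRange_oneSubLaplacianInv : DenseRange (oneSubLaplacianInv n) := by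
  change Dense ((LinearMap.range (oneSubLaplacianInv n).toLinearMap : Submodule ℂ (L2 n)) :
    Set (L2 n))
  rw [Submodule.dense_iff_topologicalClosure_eq_top, Submodule.topologicalClosure_eq_top_iff,
    Submodule.eq_bot_iff]
  intro f hf
  have h1 : inner ℂ (oneSubLaplacianInv n (oneSubLaplacianInv n f)) f = 0 := hf _ ⟨_, rfl⟩
  rw [inner_oneSubLaplacianInv, inner_self_eq_zero] at h1
  exact oneSubLaplacianInv_injective (h1.trans (map_zero _).symm)

theorem dense_sobolevSubmodule_four :
    Dense {x : SobolevH2 n | x.toL2 ∈ sobolevSubmodule n 4} := by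
  refine (denseRange_oneSubLaplacianInv.preimage
    (SobolevH2.isometryEquiv n).toHomeomorph.isOpenMap).mono ?_
  rintro x ⟨g, hg⟩
  change oneSubLaplacianInv n g = SobolevH2.isometryEquiv n x at hg
  change x.toL2 ∈ sobolevSubmodule n 4
  rw [x.toL2_eq, ← hg]
  exact oneSubLaplacianInv_sq_mem g

/-- The quadratic form of `Δ²`: `⟨u, Δ²u⟩ = ‖Δu‖²`, with `-Δu` written as `(1 - Δ)u - u`. -/
theorem re_inner_freeHamiltonian {v : L2 n} {x : SobolevH2 n}
    (h : (x.toL2, v) ∈ (freeHamiltonian n).graph) :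
    (inner ℂ x.toL2 v).re = ‖SobolevH2.isometryEquiv n x - x.toL2‖ ^ 2 := by
  obtain ⟨g, hg, rfl⟩ := mem_graph_freeHamiltonian_iff.1 h
  rw [x.toL2_eq] at hg
  have h1 := oneSubLaplacianInv_injective hg
  rw [norm_sq_eq_re_inner (𝕜 := ℂ), RCLike.re_eq_complex_re, x.toL2_eq, h1]
  congr 1
  simp only [inner_add_right, inner_sub_left, inner_sub_right, inner_smul_right,
    inner_oneSubLaplacianInv]
  ring

theorem SobolevH2.norm_le_add (x : SobolevH2 n) :
    ‖x‖ ≤ ‖x.toL2‖ + ‖SobolevH2.isometryEquiv n x - x.toL2‖ := by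
  rw [← (SobolevH2.isometryEquiv n).norm_map x]
  exact norm_le_norm_add_norm_sub' _ _

theorem SobolevH2.norm_sub_toL2_le (x : SobolevH2 n) :
    ‖SobolevH2.isometryEquiv n x - x.toL2‖ ≤ 2 * ‖x‖ := by
  refine (norm_sub_le _ _).trans ?_
  rw [(SobolevH2.isometryEquiv n).norm_map]
  linarith [x.norm_toL2_le]

/-- Interpolation of `H²` between `L²` and `H⁴`. -/
theorem SobolevH2.norm_le_of_mem_graph {v : L2 n} {x : SobolevH2 n}
    (h : (x.toL2, v) ∈ (freeHamiltonian n).graph) :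
    ‖x‖ ≤ ‖x.toL2‖ + √(‖x.toL2‖ * ‖v‖) := by
  refine x.norm_le_add.trans (add_le_add_right (Real.le_sqrt_of_sq_le ?_) _)
  rw [← re_inner_freeHamiltonian h]
  exact (Complex.re_le_norm _).trans (norm_inner_le_norm _ _)

end SobolevH2

/-! ### Operators that are bounded on `H²` and `H⁴` -/

section SobolevBounded

variable {n : ℕ}

/-- `T` is a contraction on `L²` that maps `H⁴` into itself, with `‖Δ²Tu‖ ≤ ‖Δ²u‖ + a‖u‖`, and
that is bounded by `b` in the norm of `H²`. The last condition is imposed on the dense subspace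
`H⁴` only, where `Tu ∈ H²` is known from the second one. -/
structure IsSobolevBounded (a b : ℝ) (T : L2 n →L[ℂ] L2 n) : Prop where
  norm_apply_le : ∀ u, ‖T u‖ ≤ ‖u‖
  exists_mem_graph : ∀ u v, (u, v) ∈ (freeHamiltonian n).graph →
    ∃ w, (T u, w) ∈ (freeHamiltonian n).graph ∧ ‖w‖ ≤ ‖v‖ + a * ‖u‖
  norm_le : ∀ x y : SobolevH2 n, x.toL2 ∈ sobolevSubmodule n 4 → y.toL2 = T x.toL2 →
    ‖y‖ ≤ b * ‖x‖

theorem mem_sobolevSubmodule_of_mem_graph {u v : L2 n} (h : (u, v) ∈ (freeHamiltonian n).graph) :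
    u ∈ sobolevSubmodule n 4 :=
  (freeHamiltonian n).mem_domain_of_mem_graph h

theorem exists_mem_graph_freeHamiltonian {u : L2 n} (h : u ∈ sobolevSubmodule n 4) :
    ∃ v, (u, v) ∈ (freeHamiltonian n).graph :=
  ⟨_, (freeHamiltonian n).mem_graph ⟨u, h⟩⟩

theorem IsSobolevBounded.mem {a b : ℝ} {T : L2 n →L[ℂ] L2 n} (hT : IsSobolevBounded a b T)
    {u : L2 n} (h : u ∈ sobolevSubmodule n 4) : T u ∈ sobolevSubmodule n 4 := by
  obtain ⟨v, hv⟩ := exists_mem_graph_freeHamiltonian h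
  obtain ⟨w, hw, -⟩ := hT.exists_mem_graph u v hv
  exact mem_sobolevSubmodule_of_mem_graph hw

theorem IsSobolevBounded.comp {a b a' b' : ℝ} (ha : 0 ≤ a) (hb : 0 ≤ b) {T T' : L2 n →L[ℂ] L2 n}
    (hT : IsSobolevBounded a b T) (hT' : IsSobolevBounded a' b' T') :
    IsSobolevBounded (a' + a) (b * b') (T ∘L T') where
  norm_apply_le u := (hT.norm_apply_le _).trans (hT'.norm_apply_le u)
  exists_mem_graph u v h := by
    obtain ⟨w, hw, hwv⟩ := hT'.exists_mem_graph u v h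
    obtain ⟨z, hz, hzw⟩ := hT.exists_mem_graph _ _ hw
    refine ⟨z, hz, ?_⟩
    have h1 := mul_le_mul_of_nonneg_left (hT'.norm_apply_le u) ha
    linarith
  norm_le x y hx hy := by
    obtain ⟨z, hz⟩ := SobolevH2.exists_toL2_eq (sobolevSubmodule_four_le (hT'.mem hx))
    have h1 := hT'.norm_le x z hx hz
    have h2 := hT.norm_le z y (by rw [hz]; exact hT'.mem hx) (by rw [hz]; exact hy)
    rw [mul_assoc]
    exact h2.trans (mul_le_mul_of_nonneg_left h1 hb)

theorem abs_re_inner_potentialMul_le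
    (V : Lp ℝ ∞ (volume : Measure (EuclideanSpace ℝ (Fin n)))) (u : L2 n) :
    |(inner ℂ u (potentialMul V u)).re| ≤ ‖V‖ * ‖u‖ ^ 2 := by
  refine (Complex.abs_re_le_norm _).trans ((norm_inner_le_norm _ _).trans ?_)
  nlinarith [norm_potentialMul_le V u, norm_nonneg u]

/-- The quadratic form of `H` is bounded below by `-‖V‖`. -/
theorem neg_le_re_inner_hamiltonian
    {V : Lp ℝ ∞ (volume : Measure (EuclideanSpace ℝ (Fin n)))} {u v : L2 n}
    (h : (u, v) ∈ (hamiltonian V).graph) : -(‖V‖ * ‖u‖ ^ 2) ≤ (inner ℂ u v).re := by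
  have h1 := mem_graph_hamiltonian_iff.1 h
  obtain ⟨x, rfl⟩ := SobolevH2.exists_toL2_eq
    (sobolevSubmodule_four_le (mem_sobolevSubmodule_of_mem_graph h1))
  have h2 := re_inner_freeHamiltonian h1
  rw [inner_sub_right, Complex.sub_re] at h2
  have h3 := abs_le.1 (abs_re_inner_potentialMul_le V x.toL2)
  nlinarith [sq_nonneg ‖SobolevH2.isometryEquiv n x - x.toL2‖]

/-- A contraction that preserves the graph of `H` and almost decreases its quadratic form is Sobolev
bounded: as `V` is bounded, `H` and `Δ²` have equivalent graph norms and equivalent form norms. -/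
theorem isSobolevBounded_of_mem_graph
    (V : Lp ℝ ∞ (volume : Measure (EuclideanSpace ℝ (Fin n)))) {T : L2 n →L[ℂ] L2 n}
    (hT : ∀ u, ‖T u‖ ≤ ‖u‖)
    (hg : ∀ u v, (u, v) ∈ (hamiltonian V).graph → (T u, T v) ∈ (hamiltonian V).graph)
    (hf : ∀ u v, (u, v) ∈ (hamiltonian V).graph →
      (inner ℂ (T u) (T v)).re ≤ (inner ℂ u v).re + ‖V‖ * ‖u‖ ^ 2) :
    IsSobolevBounded (2 * ‖V‖) (3 + ‖V‖) T := by
  have hH : ∀ {u v : L2 n}, (u, v) ∈ (freeHamiltonian n).graph →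
      (u, v + potentialMul V u) ∈ (hamiltonian V).graph := fun h => by
    rw [mem_graph_hamiltonian_iff, add_sub_cancel_right]
    exact h
  refine ⟨hT, fun u v h => ?_, fun x y hx hy => ?_⟩
  · refine ⟨_, mem_graph_hamiltonian_iff.1 (hg _ _ (hH h)), ?_⟩
    have h1 := norm_sub_le (T (v + potentialMul V u)) (potentialMul V (T u))
    have h2 := (hT (v + potentialMul V u)).trans (norm_add_le _ _)
    have h3 := norm_potentialMul_le V u
    have h4 := (norm_potentialMul_le V (T u)).trans
      (mul_le_mul_of_nonneg_left (hT u) (norm_nonneg V))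
    linarith
  · obtain ⟨v, hv⟩ := exists_mem_graph_freeHamiltonian hx
    have h1 := hg _ _ (hH hv)
    have h2 := mem_graph_hamiltonian_iff.1 h1
    have h3 := hf _ _ (hH hv)
    have h4 := re_inner_freeHamiltonian hv
    have hTx := hT x.toL2
    rw [← hy] at h2 h3 hTx
    have h5 := re_inner_freeHamiltonian h2
    rw [inner_add_right, Complex.add_re, h4] at h3
    rw [inner_sub_right, Complex.sub_re] at h5
    have h6 := abs_le.1 (abs_re_inner_potentialMul_le V x.toL2)
    have h7 := abs_le.1 (abs_re_inner_potentialMul_le V y.toL2)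
    have h8 : ‖y.toL2‖ ^ 2 ≤ ‖x.toL2‖ ^ 2 := pow_le_pow_left₀ (norm_nonneg _) hTx 2
    have h9 : ‖x.toL2‖ ^ 2 ≤ ‖x‖ ^ 2 := pow_le_pow_left₀ (norm_nonneg _) x.norm_toL2_le 2
    have h10 := pow_le_pow_left₀ (norm_nonneg _) x.norm_sub_toL2_le 2
    have h11 := mul_le_mul_of_nonneg_left h8 (norm_nonneg V)
    have h12 := mul_le_mul_of_nonneg_left h9 (norm_nonneg V)
    have h13 : ‖SobolevH2.isometryEquiv n y - y.toL2‖ ≤ (2 + ‖V‖) * ‖x‖ := by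
      refine le_of_sq_le_sq ?_ (by positivity)
      -- `4 + 3‖V‖ ≤ (2 + ‖V‖)²`
      nlinarith [norm_nonneg V, mul_nonneg (norm_nonneg V) (sq_nonneg ‖x‖),
        mul_nonneg (sq_nonneg ‖V‖) (sq_nonneg ‖x‖)]
    have h14 := y.norm_le_add
    have h15 := hTx.trans x.norm_toL2_le
    linarith

theorem isSobolevBounded_unitaryGroup_hamiltonian
    (V : Lp ℝ ∞ (volume : Measure (EuclideanSpace ℝ (Fin n)))) (t : ℝ) :
    IsSobolevBounded (2 * ‖V‖) (3 + ‖V‖) (unitaryGroup (hamiltonian V) t) := by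
  have hU := isUnitaryGroup_hamiltonian V
  refine isSobolevBounded_of_mem_graph V
    (fun u => (norm_map_of_mem_unitary (hU.mem_unitary t) u).le)
    (fun u v h => hU.mem_graph_apply h t) fun u v h => ?_
  rw [ContinuousLinearMap.inner_map_map_of_mem_unitary (hU.mem_unitary t)]
  exact le_add_of_nonneg_right (by positivity)

theorem hamiltonian_zero :
    hamiltonian (0 : Lp ℝ ∞ (volume : Measure (EuclideanSpace ℝ (Fin n)))) = freeHamiltonian n := by
  refine LinearPMap.eq_of_eq_graph (Submodule.ext fun p => ?_)
  have h : potentialMul (0 : Lp ℝ ∞ (volume : Measure (EuclideanSpace ℝ (Fin n)))) p.1 = 0 :=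
    Lp.zero_smul ℝ ∞ p.1
  rw [show p = (p.1, p.2) from rfl, mem_graph_hamiltonian_iff, h, sub_zero]

/-- The free group is the case `V = 0`. -/
theorem isSobolevBounded_unitaryGroup_freeHamiltonian (t : ℝ) :
    IsSobolevBounded 0 3 (unitaryGroup (freeHamiltonian n) t) := by
  have h := isSobolevBounded_unitaryGroup_hamiltonian
    (0 : Lp ℝ ∞ (volume : Measure (EuclideanSpace ℝ (Fin n)))) t
  rwa [hamiltonian_zero, norm_zero, mul_zero, add_zero] at h

theorem isSobolevBounded_acProj_hamiltonian
    (V : Lp ℝ ∞ (volume : Measure (EuclideanSpace ℝ (Fin n)))) :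
    IsSobolevBounded (2 * ‖V‖) (3 + ‖V‖) (acProj (hamiltonian V)) := by
  have hU := isUnitaryGroup_hamiltonian V
  refine isSobolevBounded_of_mem_graph V (norm_acProj_apply_le _)
    (fun u v h => acProj_mem_graph hU h) fun u v h => ?_
  set P := acProj (hamiltonian V)
  -- The form splits along the projection, and its part off the range of `P` is bounded below.
  have hQ : (u - P u, v - P v) ∈ (hamiltonian V).graph :=
    (hamiltonian V).graph.sub_mem h (acProj_mem_graph hU h)
  have h1 := neg_le_re_inner_hamiltonian hQ
  have h2 : inner ℂ (P u) (v - P v) = 0 := inner_acProj_sub_acProj _ u v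
  have h3 : inner ℂ (u - P u) (P v) = 0 :=
    inner_eq_zero_symm.1 (inner_acProj_sub_acProj _ v u)
  have h4 : inner ℂ u v = inner ℂ (P u) (P v) + inner ℂ (u - P u) (v - P v) := by
    have h5 : inner ℂ u v = inner ℂ (P u + (u - P u)) (P v + (v - P v)) := by
      rw [add_sub_cancel, add_sub_cancel]
    rw [h5, inner_add_left, inner_add_right, inner_add_right, h2, h3]
    ring
  have h5 : ‖u - P u‖ ^ 2 ≤ ‖u‖ ^ 2 := by
    have h6 := norm_add_sq_eq_norm_sq_add_norm_sq_of_inner_eq_zero (𝕜 := ℂ) (P u) (u - P u)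
      (inner_acProj_sub_acProj _ u u)
    rw [add_sub_cancel] at h6
    nlinarith [norm_nonneg (P u)]
  rw [h4, Complex.add_re]
  have h7 := mul_le_mul_of_nonneg_left h5 (norm_nonneg V)
  linarith

/-! ### Strong limits on `H²` -/

/-- By density of `H⁴` in `H²`, a Sobolev bounded operator restricts to a bounded operator
on `H²`. -/
theorem IsSobolevBounded.exists_restriction {a b : ℝ} {T : L2 n →L[ℂ] L2 n}
    (hT : IsSobolevBounded a b T) : ∃ S : SobolevH2 n →L[ℂ] SobolevH2 n,
      (∀ x, (S x).toL2 = T x.toL2) ∧ ∀ x, ‖S x‖ ≤ b * ‖x‖ := by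
  have hex : ∀ x : SobolevH2 n, ∃ y : SobolevH2 n, y.toL2 = T x.toL2 ∧ ‖y‖ ≤ b * ‖x‖ := fun x => by
    obtain ⟨s, hs, hsx⟩ := mem_closure_iff_seq_limit.1 (dense_sobolevSubmodule_four x)
    choose y hy using fun m => SobolevH2.exists_toL2_eq (sobolevSubmodule_four_le (hT.mem (hs m)))
    have hyc : CauchySeq y := by
      have hsc := hsx.cauchySeq
      rw [Metric.cauchySeq_iff] at hsc ⊢
      intro ε hε
      obtain ⟨N, hN⟩ := hsc (ε / (|b| + 1)) (by positivity)
      refine ⟨N, fun m hm p hp => ?_⟩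
      have h1 := hN m hm p hp
      rw [dist_eq_norm, lt_div_iff₀ (by positivity)] at h1
      rw [dist_eq_norm]
      have h2 := hT.norm_le (s m - s p) (y m - y p)
        (by rw [map_sub]; exact Submodule.sub_mem _ (hs m) (hs p))
        (by rw [map_sub, map_sub, map_sub, hy, hy])
      nlinarith [norm_nonneg (s m - s p), le_abs_self b]
    obtain ⟨z, hz⟩ := cauchySeq_tendsto_of_complete hyc
    refine ⟨z, ?_, ?_⟩
    · refine tendsto_nhds_unique ((SobolevH2.continuous_toL2.tendsto z).comp hz) ?_
      have h1 := ((T.continuous.comp SobolevH2.continuous_toL2).tendsto x).comp hsx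
      exact h1.congr fun m => (hy m).symm
    · exact le_of_tendsto_of_tendsto' hz.norm (hsx.norm.const_mul b)
        fun m => hT.norm_le _ _ (hs m) (hy m)
  choose S hS hSb using hex
  let L : SobolevH2 n →ₗ[ℂ] SobolevH2 n :=
    { toFun := S
      map_add' := fun x y => SobolevH2.toL2_injective (by
        rw [hS, map_add, map_add, map_add, hS, hS])
      map_smul' := fun c x => SobolevH2.toL2_injective (by
        rw [hS, map_smul, map_smul, map_smul, hS]; rfl) }
  exact ⟨L.mkContinuous b hSb, hS, hSb⟩

/-- Strong convergence on `L²` of a uniformly Sobolev bounded family implies strong convergence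
on `H²`: on `H⁴` by interpolation between `L²` and `H⁴`, and on `H²` by density. -/
theorem strongLimitExistsOnH2_of_isSobolevBounded {a b : ℝ} {T : ℝ → L2 n →L[ℂ] L2 n}
    {l : Filter ℝ} [l.NeBot] (hT : ∀ t, IsSobolevBounded a b (T t))
    (h : StrongLimitExists T l) : StrongLimitExistsOnH2 T l := by
  choose S hS hSb using fun t => (hT t).exists_restriction
  refine ⟨S, hS, exists_tendsto_apply_of_dense hSb dense_sobolevSubmodule_four fun x hx => ?_⟩
  obtain ⟨v, hv⟩ := exists_mem_graph_freeHamiltonian hx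
  obtain ⟨W, hW⟩ := h
  set K := 2 * (‖v‖ + a * ‖x.toL2‖)
  have hbound : ∀ s t, ‖S s x - S t x‖ ≤
      ‖T s x.toL2 - T t x.toL2‖ + √(‖T s x.toL2 - T t x.toL2‖ * K) := fun s t => by
    obtain ⟨w, hw, hwv⟩ := (hT s).exists_mem_graph _ _ hv
    obtain ⟨z, hz, hzv⟩ := (hT t).exists_mem_graph _ _ hv
    have e : (S s x - S t x).toL2 = T s x.toL2 - T t x.toL2 := by rw [map_sub, hS, hS]
    have hg : ((S s x - S t x).toL2, w - z) ∈ (freeHamiltonian n).graph := by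
      rw [e]
      exact (freeHamiltonian n).graph.sub_mem hw hz
    have h1 := SobolevH2.norm_le_of_mem_graph hg
    rw [e] at h1
    refine h1.trans (add_le_add_right (Real.sqrt_le_sqrt ?_) _)
    refine mul_le_mul_of_nonneg_left ((norm_sub_le _ _).trans ?_) (norm_nonneg _)
    simp only [K]
    linarith
  have hφ : Tendsto (fun r : ℝ => r + √(r * K)) (𝓝 0) (𝓝 0) := by
    have hc : Continuous fun r : ℝ => r + √(r * K) := by fun_prop
    simpa using hc.tendsto 0
  refine Metric.cauchy_iff.2 ⟨inferInstance, fun ε hε => ?_⟩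
  obtain ⟨δ, hδ, hδε⟩ := Metric.tendsto_nhds_nhds.1 hφ ε hε
  obtain ⟨s, hs, hsδ⟩ := (Metric.cauchy_iff.1 (hW x.toL2).cauchy_map).2 δ hδ
  refine ⟨(fun t => S t x) '' {t | T t x.toL2 ∈ s}, image_mem_map hs, ?_⟩
  rintro _ ⟨p, hp, rfl⟩ _ ⟨q, hq, rfl⟩
  have h1 := hsδ _ hp _ hq
  rw [dist_eq_norm] at h1 ⊢
  have h2 := hδε (x := ‖T p x.toL2 - T q x.toL2‖) (by
    rw [Real.dist_eq, sub_zero, abs_of_nonneg (norm_nonneg _)]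
    exact h1)
  rw [Real.dist_eq, sub_zero] at h2
  exact (hbound p q).trans_lt ((le_abs_self _).trans_lt h2)

theorem isSobolevBounded_waveFamily
    (V : Lp ℝ ∞ (volume : Measure (EuclideanSpace ℝ (Fin n)))) (t : ℝ) :
    IsSobolevBounded (0 + 2 * ‖V‖) ((3 + ‖V‖) * 3) (waveFamily V t) :=
  (isSobolevBounded_unitaryGroup_hamiltonian V t).comp (by positivity) (by positivity)
    (isSobolevBounded_unitaryGroup_freeHamiltonian (-t))

theorem isSobolevBounded_inverseWaveFamily
    (V : Lp ℝ ∞ (volume : Measure (EuclideanSpace ℝ (Fin n)))) (t : ℝ) :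
    IsSobolevBounded (2 * ‖V‖ + 2 * ‖V‖ + 0) (3 * ((3 + ‖V‖) * (3 + ‖V‖)))
      (inverseWaveFamily V t) :=
  (isSobolevBounded_unitaryGroup_freeHamiltonian t).comp le_rfl (by positivity)
    ((isSobolevBounded_unitaryGroup_hamiltonian V (-t)).comp (by positivity) (by positivity)
      (isSobolevBounded_acProj_hamiltonian V))

end SobolevBounded

theorem proposition10p1 (n : ℕ) (hn : 1 ≤ n)
    (V : Lp ℝ ∞ (volume : Measure (EuclideanSpace ℝ (Fin n)))) (hV : VanishesAtInfinity V) :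
    (StrongLimitExists (waveFamily V) atTop → StrongLimitExistsOnH2 (waveFamily V) atTop) ∧
    (StrongLimitExists (waveFamily V) atBot → StrongLimitExistsOnH2 (waveFamily V) atBot) ∧
    (StrongLimitExists (inverseWaveFamily V) atTop →
      StrongLimitExistsOnH2 (inverseWaveFamily V) atTop) ∧
    (StrongLimitExists (inverseWaveFamily V) atBot →
      StrongLimitExistsOnH2 (inverseWaveFamily V) atBot) :=
  ⟨strongLimitExistsOnH2_of_isSobolevBounded (isSobolevBounded_waveFamily V),
    strongLimitExistsOnH2_of_isSobolevBounded (isSobolevBounded_waveFamily V),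
    strongLimitExistsOnH2_of_isSobolevBounded (isSobolevBounded_inverseWaveFamily V),
    strongLimitExistsOnH2_of_isSobolevBounded (isSobolevBounded_inverseWaveFamily V)⟩
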